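/- Let $(U,\rho)$ be a finite metric space with $n=|U|$ points, all distances between distinct points being at least $1$, and with diameter $\triangle=2^L$ for an integer $L\ge 1$. For nonempty $F\subseteq U$ and $D\subseteq U$ let $cost(F,D)=\sum_{v\in D}\min_{f\in F}\rho(v,f)$ and $OPT_k(D)=\min_{F\subseteq U,\,|F|=k}cost(F,D)$. Consider the following randomized algorithm (DP-HST initialization), with input $U$, a demand set $D\subseteq U$, an integer $1\le k\le n$ and $\epsilon>0$. 1. Tree. Build a random 2-HST $T$ whose nodes are clusters of points with a level $h\in\{0,\dots,L\}$; the root is $U$ at level $L$. A node $S$ of level $h+1\geq 1$ with at least two points is split as follows, independently of all other splits: draw a uniformly random ordering of the points and a radius $r=s\cdot 2^h$ with $s$ uniform on $[1/2,1]$; going through the points $v\in S$ in this order, let $C_v$ be the set of the points $u\in S$ with $\rho(v,u)\le r$ that belong to no earlier cluster. The nonempty $C_v$ are the children of $S$, at level $h$. Nodes with one point and nodes of level $0$ are leaves. 2. Noise. For each node $v$ of level $h_v$, with set of points $T(v)$, put $\hat N_v=|D\cap T(v)|+X_v$, where the $X_v$ are independent of each other and of the tree and $X_v$ is a centered Laplace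 variable of scale $2^{L-h_v}/\epsilon$. Let $score(v)=\hat N_v\,2^{h_v}$. 3. Subtree search. Start with $C_1=\emptyset$. While $|C_1|<k$, add to $C_1$ the $k-|C_1|$ nodes of highest score among the nodes that are neither in $C_1$ nor ancestors of nodes in $C_1$, and then remove from $C_1$ every node that has a descendant in $C_1$. 4. Leaf search. From each node of $C_1$, move repeatedly to the child $w$ with the largest $\hat N_w$ until a leaf is reached. Output the set $C_0$ of the points at these leaves. Ties in steps 3 and 4 are broken by a fixed enumeration of the nodes. Then for every integer $A\ge 0$ there is a constant $C>0$, depending only on $A$, such that for all $U,\rho,L,D,k,\epsilon$ as above with $L=\log_2\triangle\le n^A$: almost surely $|C_0|=k$, the random variable $cost(C_0,D)$ is integrable, and $$E[cost(C_0,D)]\le C\log n\,\bigl(OPT_k(D)+k\,\epsilon^{-1}\triangle\log n\bigr).$$ -/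

import Mathlib

open MeasureTheory ProbabilityTheory

noncomputable section

namespace KMedian

/-! ### The k-median cost -/

/-- `cost F D = ∑_{v ∈ D} min_{f ∈ F} ρ(v, f)`, for a nonempty finite set `F` of centers. -/
def cost {U : Type*} [MetricSpace U] (F D : Finset U) : ℝ :=
  ∑ v ∈ D, Metric.infDist v (F : Set U)

/-- The least cost on `D` of a set of exactly `k` centers of the universe `U`. -/
def opt {U : Type*} [MetricSpace U] (k : ℕ) (D : Finset U) : ℝ :=
  ⨅ F : {F : Finset U // F.card = k}, cost F.1 D

/-! ### The random 2-HST -/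

/-- An ordering (permutation) of the points of `U`: `π v` is the position of `v`. -/
def PointOrder (U : Type*) [Fintype U] : Type _ := U ≃ Fin (Fintype.card U)

instance (U : Type*) [Fintype U] : MeasurableSpace (PointOrder U) := ⊤

/-- The cluster of the center `v` when the points of `S` are processed in the order `π`:
the points of `S` within distance `r` of `v` that no earlier center of `S` has taken. -/
def ballCluster {U : Type*} [Fintype U] [MetricSpace U] (π : U ≃ Fin (Fintype.card U)) (r : ℝ)
    (S : Finset U) (v : U) : Finset U :=
  open Classical in
  S.filter fun u => dist v u ≤ r ∧ ∀ v' ∈ S, π v' < π v → ¬ dist v' u ≤ r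

/-- The partition of `S` into its nonempty clusters. -/
def ballPartition {U : Type*} [Fintype U] [MetricSpace U] (π : U ≃ Fin (Fintype.card U)) (r : ℝ)
    (S : Finset U) : Finset (Finset U) :=
  open Classical in
  (S.image (ballCluster π r S)).filter Finset.Nonempty

/-- A node of an `L`-level tree: its level `h ∈ {0, …, L}` (the root has level `L`) and the set
of the data points in the subtree below it. -/
abbrev Node (U : Type*) (L : ℕ) : Type _ := Fin (L + 1) × Finset U

/-- The randomness of the tree: the call that splits a node `(h + 1, S)` into nodes of level `h`
uses its own ordering and its own radius factor, stored at the index `(h, S)`. -/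
abbrev TreeSeed (U : Type*) [Fintype U] (L : ℕ) : Type _ := Fin L × Finset U → PointOrder U × ℝ

/-- The nodes of the 2-HST built on the cluster `S`, whose root has level `h`. A cluster of level
`h + 1` with more than one point is partitioned with radius `s * 2 ^ h`, where `s` is the radius
factor of the call; the recursion ends at level `0` or at a single point. -/
def hst {U : Type*} [Fintype U] [MetricSpace U] {L : ℕ} (τ : TreeSeed U L) :
    (h : ℕ) → h < L + 1 → Finset U → Finset (Node U L)
  | 0, hh, S => {(⟨0, hh⟩, S)}
  | h + 1, hh, S =>
    open Classical in
    insert (⟨h + 1, hh⟩, S)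
      (if S.card ≤ 1 then ∅
      else
        (ballPartition (τ (⟨h, Nat.lt_of_succ_lt_succ hh⟩, S)).1
          ((τ (⟨h, Nat.lt_of_succ_lt_succ hh⟩, S)).2 * 2 ^ h) S).biUnion
            fun S' => hst τ h (Nat.lt_of_succ_lt hh) S')

/-- The `L`-level 2-HST on the whole universe. -/
def hstTree {U : Type*} [Fintype U] [MetricSpace U] {L : ℕ} (τ : TreeSeed U L) :
    Finset (Node U L) :=
  hst τ L (Nat.lt_succ_self L) Finset.univ

/-- Independently for each call, a uniformly random ordering and a radius factor that is
uniform on `[1/2, 1]`. -/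
def treeSeedLaw (U : Type*) [Fintype U] (L : ℕ) : Measure (TreeSeed U L) :=
  Measure.pi fun _ =>
    (uniformOn (Set.univ : Set (PointOrder U))).prod
      ((volume : Measure ℝ)[|Set.Icc (1 / 2 : ℝ) 1])

/-! ### The search for centers on the tree -/

/-- For two nodes of a tree: `w` is a proper descendant of `v`. -/
def IsDescendant {U : Type*} {L : ℕ} (w v : Node U L) : Prop :=
  w.1 < v.1 ∧ w.2 ⊆ v.2

/-- The children of `v` in the tree `T`. -/
def children {U : Type*} {L : ℕ} (T : Finset (Node U L)) (v : Node U L) : Finset (Node U L) :=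
  open Classical in
  T.filter fun w => (w.1 : ℕ) + 1 = (v.1 : ℕ) ∧ w.2 ⊆ v.2

/-- The `j` nodes of `S` with the highest values of `f` (all of `S` if it has at most `j` nodes);
ties are broken by a fixed enumeration of the nodes. -/
def top {U : Type*} [Fintype U] {L : ℕ} (f : Node U L → ℝ) (j : ℕ) (S : Finset (Node U L)) :
    Finset (Node U L) :=
  open Classical in
  S.filter fun v =>
    (S.filter fun w => f v < f w ∨
      (f w = f v ∧ Fintype.equivFin (Node U L) w < Fintype.equivFin (Node U L) v)).card < j

/-- One round of the subtree search: if fewer than `k` nodes are held, add the missing number of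
nodes of highest score, among the nodes that are neither held already nor ancestors of held nodes;
then remove every held node that has a held descendant. -/
def subtreeRound {U : Type*} [Fintype U] {L : ℕ} (T : Finset (Node U L)) (score : Node U L → ℝ)
    (k : ℕ) (C : Finset (Node U L)) : Finset (Node U L) :=
  open Classical in
  if C.card < k then
    let C' := C ∪ top score (k - C.card)
      (T.filter fun v => v ∉ C ∧ ∀ w ∈ C, ¬ IsDescendant w v)
    C'.filter fun v => ¬ ∃ w ∈ C', IsDescendant w v
  else C

/-- The subtree search. A node is added at most once (if it is removed, it remains an ancestor of
a held node), so the loop has stopped after as many rounds as there are nodes. -/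
def subtreeSearch {U : Type*} [Fintype U] {L : ℕ} (T : Finset (Node U L)) (score : Node U L → ℝ)
    (k : ℕ) : Finset (Node U L) :=
  (subtreeRound T score k)^[T.card] ∅

/-- One step of the leaf search: replace every node that is not a leaf by its child with the
largest count. -/
def descend {U : Type*} [Fintype U] {L : ℕ} (T : Finset (Node U L)) (count : Node U L → ℝ)
    (C : Finset (Node U L)) : Finset (Node U L) :=
  open Classical in
  C.biUnion fun v => if children T v = ∅ then {v} else top count 1 (children T v)

/-- The leaf search, from each of the nodes in `C`: the data points at the leaves that are reached
after (at most) `L` steps. -/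
def findLeaf {U : Type*} [Fintype U] {L : ℕ} (T : Finset (Node U L)) (count : Node U L → ℝ)
    (C : Finset (Node U L)) : Finset U :=
  open Classical in
  ((descend T count)^[L] C).biUnion fun v => v.2

/-! ### DP-HST initialization -/

/-- The centered Laplace distribution with scale `b`. -/
def laplace (b : ℝ) : Measure ℝ :=
  volume.withDensity fun x => ENNReal.ofReal (Real.exp (-|x| / b) / (2 * b))

/-- The noise of the nodes: independent, with scale `2 ^ (L - h) / ε` for a node of level `h`. -/
def noiseLaw (U : Type*) [Fintype U] (L : ℕ) (ε : ℝ) : Measure (Node U L → ℝ) :=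
  Measure.pi fun v => laplace (2 ^ (L - (v.1 : ℕ)) / ε)

/-- The perturbed count `|D ∩ T(v)| +` noise. -/
def noisyCount {U : Type*} {L : ℕ} (D : Finset U) (X : Node U L → ℝ) (v : Node U L) : ℝ :=
  open Classical in
  ((D ∩ v.2).card : ℝ) + X v

/-- The output of DP-HST initialization, as a function of the randomness of the tree and of the
noise of the nodes. -/
def dpHst {U : Type*} [Fintype U] [MetricSpace U] {L : ℕ} (D : Finset U) (k : ℕ)
    (ω : TreeSeed U L × (Node U L → ℝ)) : Finset U :=
  let T := hstTree ω.1
  let count := noisyCount D ω.2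
  findLeaf T count (subtreeSearch T (fun v => count v * 2 ^ (v.1 : ℕ)) k)

/-- The law of all the randomness: the noise is independent of the tree. -/
def dpHstLaw (U : Type*) [Fintype U] (L : ℕ) (ε : ℝ) :
    Measure (TreeSeed U L × (Node U L → ℝ)) :=
  (treeSeedLaw U L).prod (noiseLaw U L ε)

end KMedian

end

/-! Fix a tree and let the missed weight of a center set `F` be the sum of `|D ∩ T(v)| * 2 ^ h` over
the nodes `v` of level `h` that contain no point of `F`. It serves as a tree version of the cost,
and three facts about it combine.

Domination: on every tree the cost is at most 4 times the missed weight (`cost_le_missWeight`). In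
expectation, the missed weight is at most `O(log n)` times the cost (`integral_missWeight_le`). The
latter is the usual analysis of random ball partitions. A split that separates `x` from `y` is
charged to one center, which must precede every point at least as near to the pair, and the radius
must fall in a window of length at most `dist x y`. Summing the probabilities over the centers gives
a difference of harmonic numbers, and these differences telescope over the levels
(`lintegral_sepWeight_le`).

Search: if the noise of each score is at most `M`, the output misses at most 3 times the weight
missed by any `k` centers, plus `4 * k * M` (`missWeight_findLeaf_le`). The `k` points of `F` are
matched with the `k` held nodes. What the output loses at a point of `F` is paid for, up to `2 * M`,
by a node inside the matched held node that `F` misses. The held nodes are disjoint, so no node pays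
twice.

Noise: a node of level `h` has noise of scale `2 ^ (L - h) / ε`, so the noise of every score has the
same scale `2 ^ L / ε`. A tree has at most `n * (L + 1)` nodes, and an exponential moment bounds the
expected maximum by a multiple of `2 ^ L / ε * log (n * (L + 1))` up to an additive `O(2 ^ L / ε)`
(`integral_cost_dpHst_le`). The assumption `L ≤ n ^ A` turns this logarithm into `O(log n)`.

All random objects take finitely many values, so integrability and the use of Fubini reduce to
measurability of fibers. -/

namespace KMedian

/-! ### Selecting the nodes of highest value -/

open scoped Classical in
theorem mem_top {U : Type*} [Fintype U] {L : ℕ} {f : Node U L → ℝ} {j : ℕ}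
    {S : Finset (Node U L)} {v : Node U L} :
    v ∈ top f j S ↔ v ∈ S ∧ (S.filter fun w => f v < f w ∨
      (f w = f v ∧ Fintype.equivFin (Node U L) w < Fintype.equivFin (Node U L) v)).card < j := by
  simp only [top, Finset.mem_filter]

theorem top_subset {U : Type*} [Fintype U] {L : ℕ} (f : Node U L → ℝ) (j : ℕ)
    (S : Finset (Node U L)) : top f j S ⊆ S := fun _ hv => (mem_top.1 hv).1

theorem le_of_mem_top {U : Type*} [Fintype U] {L : ℕ} {f : Node U L → ℝ} {j : ℕ}
    {S : Finset (Node U L)} {v w : Node U L} (hv : v ∈ S) (hv' : v ∉ top f j S)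
    (hw : w ∈ top f j S) : f v ≤ f w := by
  classical
  by_contra! hlt
  refine hv' (mem_top.2 ⟨hv, lt_of_le_of_lt (Finset.card_le_card ?_) (mem_top.1 hw).2⟩)
  intro u hu
  rw [Finset.mem_filter] at hu ⊢
  refine ⟨hu.1, Or.inl ?_⟩
  rcases hu.2 with h | h
  · exact hlt.trans h
  · rw [h.1]; exact hlt

/-- The strict order in which `top` lists the nodes. -/
theorem exists_injective_rank {U : Type*} [Fintype U] {L : ℕ} (f : Node U L → ℝ) :
    ∃ g : Node U L → ℝ ×ₗ Fin (Fintype.card (Node U L)), Function.Injective g ∧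
      ∀ v w, g w < g v ↔ f v < f w ∨
        (f w = f v ∧ Fintype.equivFin (Node U L) w < Fintype.equivFin (Node U L) v) := by
  refine ⟨fun v => toLex (-f v, Fintype.equivFin (Node U L) v), ?_, ?_⟩
  · intro v w h
    have := congrArg (fun p => (ofLex p).2) h
    exact (Fintype.equivFin (Node U L)).injective this
  · intro v w
    rw [Prod.Lex.toLex_lt_toLex]
    simp

/-- The last selected node in the strict order is preceded by all the other selected ones, and fewer
than `j` nodes precede it. -/
theorem card_top_le {U : Type*} [Fintype U] {L : ℕ} (f : Node U L → ℝ) (j : ℕ)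
    (S : Finset (Node U L)) : (top f j S).card ≤ j := by
  classical
  by_contra! hlt
  obtain ⟨g, hg, hlt'⟩ := exists_injective_rank f
  obtain ⟨v, hv, hmax⟩ := Finset.exists_max_image (top f j S) g
    (Finset.card_pos.1 (by omega))
  have h1 := (mem_top.1 hv).2
  have h2 : ((top f j S).erase v).card < j := by
    refine lt_of_le_of_lt (Finset.card_le_card ?_) h1
    intro w hw
    rw [Finset.mem_erase] at hw
    rw [Finset.mem_filter]
    refine ⟨top_subset _ _ _ hw.2, (hlt' v w).1 ?_⟩
    exact lt_of_le_of_ne (hmax w hw.2) (fun h => hw.1 (hg h))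
  rw [Finset.card_erase_of_mem hv] at h2
  omega

theorem top_nonempty {U : Type*} [Fintype U] {L : ℕ} (f : Node U L → ℝ) {j : ℕ} (hj : 0 < j)
    {S : Finset (Node U L)} (hS : S.Nonempty) : (top f j S).Nonempty := by
  classical
  obtain ⟨g, hg, hlt'⟩ := exists_injective_rank f
  obtain ⟨v, hv, hmin⟩ := Finset.exists_min_image S g hS
  refine ⟨v, mem_top.2 ⟨hv, ?_⟩⟩
  rw [Finset.filter_eq_empty_iff.2]
  · simpa using hj
  · intro w hw h
    exact absurd ((hlt' v w).2 h) (not_lt.2 (hmin w hw))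

theorem exists_top_one {U : Type*} [Fintype U] {L : ℕ} (f : Node U L → ℝ)
    {S : Finset (Node U L)} (hS : S.Nonempty) :
    ∃ w ∈ S, top f 1 S = {w} ∧ ∀ v ∈ S, f v ≤ f w := by
  have h1 : (top f 1 S).card = 1 :=
    le_antisymm (card_top_le f 1 S) (Finset.card_pos.2 (top_nonempty f one_pos hS))
  obtain ⟨w, hw⟩ := Finset.card_eq_one.1 h1
  have hwm : w ∈ top f 1 S := by rw [hw]; exact Finset.mem_singleton_self w
  refine ⟨w, top_subset _ _ _ hwm, hw, fun v hv => ?_⟩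
  by_cases h : v ∈ top f 1 S
  · rw [hw, Finset.mem_singleton] at h
    rw [h]
  · exact le_of_mem_top hv h hwm

/-! ### Hierarchies of clusters -/

/-- The structure of a 2-HST: a laminar family of nonempty clusters, in which a cluster that is not
a single point is covered by its children, and in which diameters are bounded by the level. -/
structure IsHierarchy {U : Type*} [Fintype U] [MetricSpace U] {L : ℕ}
    (T : Finset (Node U L)) : Prop where
  nonempty : ∀ v ∈ T, v.2.Nonempty
  root : (Fin.last L, Finset.univ) ∈ T
  laminar : ∀ v ∈ T, ∀ w ∈ T, v.1 ≤ w.1 → v.2 ⊆ w.2 ∨ Disjoint v.2 w.2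
  parent : ∀ v ∈ T, v.1 < Fin.last L → ∃ w ∈ T, (w.1 : ℕ) = v.1 + 1 ∧ v.2 ⊆ w.2
  split : ∀ v ∈ T, (∃ x, v.2 = {x}) ∨
    ∀ x ∈ v.2, ∃ w ∈ T, (w.1 : ℕ) + 1 = v.1 ∧ w.2 ⊆ v.2 ∧ x ∈ w.2
  dist_le : ∀ v ∈ T, ∀ x ∈ v.2, ∀ y ∈ v.2, dist x y ≤ 2 ^ ((v.1 : ℕ) + 1)

theorem mem_children {U : Type*} {L : ℕ} {T : Finset (Node U L)} {v w : Node U L} :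
    w ∈ children T v ↔ w ∈ T ∧ (w.1 : ℕ) + 1 = (v.1 : ℕ) ∧ w.2 ⊆ v.2 := by
  simp only [children, Finset.mem_filter]

theorem IsDescendant.trans {U : Type*} {L : ℕ} {u v w : Node U L} (h : IsDescendant u v)
    (h' : IsDescendant v w) : IsDescendant u w :=
  ⟨h.1.trans h'.1, h.2.trans h'.2⟩

namespace IsHierarchy

variable {U : Type*} [Fintype U] [MetricSpace U] {L : ℕ} {T : Finset (Node U L)}

theorem subset_of_mem (hT : IsHierarchy T) {v w : Node U L} (hv : v ∈ T) (hw : w ∈ T) {x : U}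
    (hxv : x ∈ v.2) (hxw : x ∈ w.2) (h : v.1 ≤ w.1) : v.2 ⊆ w.2 :=
  (hT.laminar v hv w hw h).resolve_right fun hd => Finset.disjoint_left.1 hd hxv hxw

theorem eq_of_mem (hT : IsHierarchy T) {v w : Node U L} (hv : v ∈ T) (hw : w ∈ T) {x : U}
    (hxv : x ∈ v.2) (hxw : x ∈ w.2) (h : v.1 = w.1) : v = w :=
  Prod.ext h ((hT.subset_of_mem hv hw hxv hxw h.le).antisymm
    (hT.subset_of_mem hw hv hxw hxv h.ge))

theorem disjoint_of_not_isDescendant (hT : IsHierarchy T) {v w : Node U L} (hv : v ∈ T)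
    (hw : w ∈ T) (hne : v ≠ w) (h1 : ¬ IsDescendant v w) (h2 : ¬ IsDescendant w v) :
    Disjoint v.2 w.2 := by
  rw [Finset.disjoint_left]
  intro x hxv hxw
  rcases lt_trichotomy v.1 w.1 with h | h | h
  · exact h1 ⟨h, hT.subset_of_mem hv hw hxv hxw h.le⟩
  · exact hne (hT.eq_of_mem hv hw hxv hxw h)
  · exact h2 ⟨h, hT.subset_of_mem hw hv hxw hxv h.le⟩

theorem eq_singleton_of_children (hT : IsHierarchy T) {v : Node U L} (hv : v ∈ T)
    (h : children T v = ∅) : ∃ x, v.2 = {x} := by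
  rcases hT.split v hv with h' | h'
  · exact h'
  · obtain ⟨x, hx⟩ := hT.nonempty v hv
    obtain ⟨w, hw, h1, h2, -⟩ := h' x hx
    have : w ∈ children T v := mem_children.2 ⟨hw, h1, h2⟩
    rw [h] at this
    exact absurd this (Finset.notMem_empty w)

theorem exists_child (hT : IsHierarchy T) {v : Node U L} (hv : v ∈ T)
    (h : (children T v).Nonempty) {x : U} (hx : x ∈ v.2) : ∃ w ∈ children T v, x ∈ w.2 := by
  rcases hT.split v hv with ⟨y, hy⟩ | h'
  · obtain ⟨w, hw⟩ := h
    refine ⟨w, hw, ?_⟩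
    have hw' := mem_children.1 hw
    obtain ⟨z, hz⟩ := hT.nonempty w hw'.1
    have hzv := hw'.2.2 hz
    rw [hy, Finset.mem_singleton] at hx hzv
    rw [hx, ← hzv]; exact hz
  · obtain ⟨w, hw, h1, h2, h3⟩ := h' x hx
    exact ⟨w, mem_children.2 ⟨hw, h1, h2⟩, h3⟩

/-- Every point of a node is the point of a leaf below it. -/
theorem exists_leaf (hT : IsHierarchy T) (v : Node U L) (hv : v ∈ T) (x : U) (hx : x ∈ v.2) :
    ∃ l ∈ T, children T l = ∅ ∧ l.2 = {x} := by
  classical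
  obtain ⟨l, hl, hmin⟩ := Finset.exists_min_image (T.filter fun w => x ∈ w.2) (fun w => w.1)
    ⟨v, Finset.mem_filter.2 ⟨hv, hx⟩⟩
  rw [Finset.mem_filter] at hl
  have hc : children T l = ∅ := by
    by_contra hne
    obtain ⟨w, hw, hxw⟩ := hT.exists_child hl.1 (Finset.nonempty_iff_ne_empty.2 hne) hl.2
    have hw' := mem_children.1 hw
    have := hmin w (Finset.mem_filter.2 ⟨hw'.1, hxw⟩)
    rw [Fin.le_def] at this
    omega
  refine ⟨l, hl.1, hc, ?_⟩
  obtain ⟨y, hy⟩ := hT.eq_singleton_of_children hl.1 hc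
  have := hl.2
  rw [hy, Finset.mem_singleton] at this
  rw [hy, this]

/-- A leaf is not an ancestor. -/
theorem not_isDescendant_leaf (hT : IsHierarchy T) {l w : Node U L} (hl : l ∈ T)
    (hc : children T l = ∅) (hw : w ∈ T) : ¬ IsDescendant w l := by
  classical
  intro h
  obtain ⟨x, hx⟩ := hT.nonempty w hw
  -- `IsDescendant` compares only levels and sets, so a child of `l` has to be found by climbing
  -- from `w`: the parent of the highest node around `x` strictly below the level of `l` lies at
  -- that level, hence is `l`.
  obtain ⟨u, hu, hmax⟩ := Finset.exists_max_image
    (T.filter fun u => x ∈ u.2 ∧ u.1 < l.1) (fun u => u.1)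
    ⟨w, Finset.mem_filter.2 ⟨hw, hx, h.1⟩⟩
  rw [Finset.mem_filter] at hu
  obtain ⟨p, hp, hp1, hp2⟩ := hT.parent u hu.1 (lt_of_lt_of_le hu.2.2 (Fin.le_last _))
  have hlt := hu.2.2
  rw [Fin.lt_def] at hlt
  have hle : ¬ p.1 < l.1 := by
    intro hlt'
    have := hmax p (Finset.mem_filter.2 ⟨hp, hp2 hu.2.1, hlt'⟩)
    rw [Fin.le_def] at this
    omega
  rw [Fin.lt_def] at hle
  have heq : p.1 = l.1 := Fin.ext (by omega)
  have hpl := hT.eq_of_mem hp hl (hp2 hu.2.1) (h.2 hx) heq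
  have : u ∈ children T l := mem_children.2 ⟨hu.1, by omega, hpl ▸ hp2⟩
  rw [hc] at this
  exact absurd this (Finset.notMem_empty u)

/-- A node is determined by its level and any one of its points. -/
theorem card_le (hT : IsHierarchy T) : T.card ≤ Fintype.card U * (L + 1) := by
  classical
  have : ∀ v : Node U L, ∃ x, v ∈ T → x ∈ v.2 := by
    intro v
    by_cases hv : v ∈ T
    · exact (hT.nonempty v hv).imp fun x hx _ => hx
    · obtain ⟨x, -⟩ := hT.nonempty _ hT.root
      exact ⟨x, fun h => absurd h hv⟩
  choose g hg using this
  have h := Finset.card_le_card_of_injOn (s := T) (t := Finset.univ)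
    (fun v => ((g v, v.1) : U × Fin (L + 1))) (fun _ _ => Finset.mem_coe.2 (Finset.mem_univ _)) (by
      intro v hv w hw h
      rw [Prod.mk.injEq] at h
      exact hT.eq_of_mem hv hw (hg v hv) (h.1 ▸ hg w hw) h.2)
  simpa using h

end IsHierarchy

/-! ### The subtree search -/

/-- The invariants of the subtree search. -/
structure SearchInvariant {U : Type*} {L : ℕ} (T : Finset (Node U L)) (score : Node U L → ℝ)
    (k : ℕ) (C : Finset (Node U L)) : Prop where
  subset : C ⊆ T
  antichain : ∀ v ∈ C, ∀ w ∈ C, ¬ IsDescendant w v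
  card_le : C.card ≤ k
  score_le : ∀ c ∈ C, ∀ v ∈ T, v ∉ C → (∀ w ∈ C, ¬ IsDescendant w v) → score v ≤ score c

theorem exists_minimal_below {U : Type*} {L : ℕ} {C : Finset (Node U L)} {w : Node U L}
    (hw : w ∈ C) : ∃ u ∈ C, (∀ z ∈ C, ¬ IsDescendant z u) ∧ (u = w ∨ IsDescendant u w) := by
  classical
  obtain ⟨u, hu, hmin⟩ := Finset.exists_min_image
    (C.filter fun u => u = w ∨ IsDescendant u w) (fun u => u.1)
    ⟨w, Finset.mem_filter.2 ⟨hw, Or.inl rfl⟩⟩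
  rw [Finset.mem_filter] at hu
  refine ⟨u, hu.1, fun z hz hzu => ?_, hu.2⟩
  refine absurd (hmin z (Finset.mem_filter.2 ⟨hz, Or.inr ?_⟩)) (not_le.2 hzu.1)
  rcases hu.2 with h | h
  · exact h ▸ hzu
  · exact hzu.trans h

open scoped Classical in
/-- The nodes that are held or ancestors of held nodes. -/
noncomputable def upClosure {U : Type*} {L : ℕ} (T C : Finset (Node U L)) : Finset (Node U L) :=
  T.filter fun v => v ∈ C ∨ ∃ w ∈ C, IsDescendant w v

/-- A removed node keeps a held descendant, so the set of held nodes and their ancestors never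
shrinks. Hence the candidates of later rounds were candidates before and lost against the nodes
chosen then, which preserves `score_le`. The same set grows strictly while fewer than `k` nodes are
held and a candidate exists, which gives termination. -/
theorem SearchInvariant.round {U : Type*} [Fintype U] {L : ℕ} {T : Finset (Node U L)}
    {score : Node U L → ℝ} {k : ℕ} {C : Finset (Node U L)} (h : SearchInvariant T score k C) :
    SearchInvariant T score k (subtreeRound T score k C) ∧
      (C.card < k → (upClosure T C).card < T.card →
        (upClosure T C).card < (upClosure T (subtreeRound T score k C)).card) := by
  classical
  by_cases hk : C.card < k
  swap
  · rw [subtreeRound, if_neg hk]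
    exact ⟨h, fun h' => absurd h' hk⟩
  set E := T.filter fun v => v ∉ C ∧ ∀ w ∈ C, ¬ IsDescendant w v with hE
  set N := top score (k - C.card) E with hN
  set C' := C ∪ N with hC'
  have hround : ∀ v, v ∈ subtreeRound T score k C ↔
      v ∈ C' ∧ ∀ w ∈ C', ¬ IsDescendant w v := by
    intro v
    rw [subtreeRound, if_pos hk]
    simp only [Finset.mem_filter, not_exists, not_and, hC', hN, hE]
  set R := subtreeRound T score k C
  have hNE : N ⊆ E := top_subset _ _ _
  have hET : E ⊆ T := Finset.filter_subset _ _
  have hC'T : C' ⊆ T := Finset.union_subset h.subset (hNE.trans hET)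
  have hRC' : R ⊆ C' := fun v hv => ((hround v).1 hv).1
  have hup : ∀ v, (v ∈ C' ∨ ∃ w ∈ C', IsDescendant w v) →
      v ∈ R ∨ ∃ w ∈ R, IsDescendant w v := by
    rintro v (hv | ⟨w, hw, hwv⟩)
    · obtain ⟨u, hu, hmin, hor⟩ := exists_minimal_below hv
      have huR := (hround u).2 ⟨hu, hmin⟩
      rcases hor with rfl | hor
      · exact Or.inl huR
      · exact Or.inr ⟨u, huR, hor⟩
    · obtain ⟨u, hu, hmin, hor⟩ := exists_minimal_below hw
      have huR := (hround u).2 ⟨hu, hmin⟩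
      rcases hor with rfl | hor
      · exact Or.inr ⟨u, huR, hwv⟩
      · exact Or.inr ⟨u, huR, hor.trans hwv⟩
  refine ⟨⟨hRC'.trans hC'T, ?_, ?_, ?_⟩, ?_⟩
  · intro v hv w hw
    exact ((hround v).1 hv).2 w (hRC' hw)
  · have h1 : N.card ≤ k - C.card := card_top_le _ _ _
    have h2 := Finset.card_union_le C N
    have h3 := Finset.card_le_card hRC'
    rw [← hC'] at h2
    omega
  · intro c hc v hv hvR hdesc
    have hnot : ¬ (v ∈ C' ∨ ∃ w ∈ C', IsDescendant w v) := by
      intro h'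
      rcases hup v h' with h' | ⟨w, hw, hwv⟩
      · exact hvR h'
      · exact hdesc w hw hwv
    push Not at hnot
    have hvC : v ∉ C := fun hh => hnot.1 (Finset.mem_union_left _ hh)
    have hdC : ∀ w ∈ C, ¬ IsDescendant w v := fun w hw => hnot.2 w (Finset.mem_union_left _ hw)
    rcases Finset.mem_union.1 (hRC' hc) with hcC | hcN
    · exact h.score_le c hcC v hv hvC hdC
    · exact le_of_mem_top (Finset.mem_filter.2 ⟨hv, hvC, hdC⟩)
        (fun hh => hnot.1 (Finset.mem_union_right _ hh)) hcN
  · intro _ hlt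
    have hEne : E.Nonempty := by
      by_contra hne
      rw [Finset.not_nonempty_iff_eq_empty, hE, Finset.filter_eq_empty_iff] at hne
      refine absurd hlt (not_lt.2 (Finset.card_le_card fun v hv => ?_))
      rw [upClosure, Finset.mem_filter]
      refine ⟨hv, ?_⟩
      by_contra hcon
      push Not at hcon
      exact hne hv hcon
    obtain ⟨e, he⟩ := top_nonempty score (j := k - C.card) (by omega) hEne
    have heE := Finset.mem_filter.1 (hNE he)
    refine Finset.card_lt_card (Finset.ssubset_iff_of_subset ?_ |>.2 ⟨e, ?_, ?_⟩)
    · intro v hv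
      rw [upClosure, Finset.mem_filter] at hv ⊢
      refine ⟨hv.1, hup v ?_⟩
      rcases hv.2 with h' | ⟨w, hw, hwv⟩
      · exact Or.inl (Finset.mem_union_left _ h')
      · exact Or.inr ⟨w, Finset.mem_union_left _ hw, hwv⟩
    · rw [upClosure, Finset.mem_filter]
      exact ⟨heE.1, hup e (Or.inl (Finset.mem_union_right _ he))⟩
    · rw [upClosure, Finset.mem_filter]
      rintro ⟨-, h' | ⟨w, hw, hwe⟩⟩
      · exact heE.2.1 h'
      · exact heE.2.2 w hw hwe

/-- When no candidate is left, every leaf is held, since a leaf is not a proper ancestor; there is a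
leaf for each point. -/
theorem IsHierarchy.card_le_of_upClosure {U : Type*} [Fintype U] [MetricSpace U] {L : ℕ}
    {T C : Finset (Node U L)} (hT : IsHierarchy T) (hC : C ⊆ T)
    (h : T.card ≤ (upClosure T C).card) : Fintype.card U ≤ C.card := by
  classical
  have hall : upClosure T C = T := Finset.eq_of_subset_of_card_le (Finset.filter_subset _ _) h
  have hleaf : ∀ x : U, ∃ l ∈ C, l.2 = {x} := by
    intro x
    obtain ⟨l, hl, hc, hx⟩ := hT.exists_leaf _ hT.root x (Finset.mem_univ x)
    refine ⟨l, ?_, hx⟩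
    have hl' := hl
    rw [← hall, upClosure, Finset.mem_filter] at hl'
    rcases hl'.2 with h' | ⟨w, hw, hwl⟩
    · exact h'
    · exact absurd hwl (hT.not_isDescendant_leaf hl hc (hC hw))
  choose g hgC hg using hleaf
  rw [← Finset.card_univ]
  refine Finset.card_le_card_of_injOn g (fun x _ => hgC x) ?_
  intro x _ y _ hxy
  have := hg x
  rw [hxy, hg y, Finset.singleton_inj] at this
  exact this.symm

theorem IsHierarchy.subtreeSearch {U : Type*} [Fintype U] [MetricSpace U] {L : ℕ}
    {T : Finset (Node U L)} (hT : IsHierarchy T) (score : Node U L → ℝ) {k : ℕ}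
    (hk : k ≤ Fintype.card U) :
    SearchInvariant T score k (subtreeSearch T score k) ∧ (subtreeSearch T score k).card = k := by
  -- The closure gains a node per round until `k` nodes are held, so `T.card` rounds either reach
  -- `k` or exhaust the tree; in the latter case at least `n ≥ k` nodes are held.
  have key : ∀ i : ℕ, SearchInvariant T score k ((subtreeRound T score k)^[i] ∅) ∧
      (((subtreeRound T score k)^[i] ∅).card = k ∨
        i ≤ (upClosure T ((subtreeRound T score k)^[i] ∅)).card) := by
    intro i
    induction i with
    | zero => exact ⟨⟨by simp, by simp, by simp, by simp⟩, Or.inr (by simp)⟩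
    | succ i ih =>
      rw [Function.iterate_succ_apply']
      set C := (subtreeRound T score k)^[i] ∅
      obtain ⟨hinv, hprog⟩ := ih.1.round
      refine ⟨hinv, ?_⟩
      rcases ih.1.card_le.lt_or_eq with hlt | heq
      · right
        have h1 := ih.2.resolve_left hlt.ne
        have h2 : (upClosure T C).card < T.card := by
          by_contra! hge
          have := hT.card_le_of_upClosure ih.1.subset hge
          omega
        have := hprog hlt h2
        omega
      · left
        rw [subtreeRound, if_neg (by omega)]
        exact heq
  obtain ⟨hinv, hor⟩ := key T.card
  refine ⟨hinv, ?_⟩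
  rcases hor with h | h
  · exact h
  · have h1 := hT.card_le_of_upClosure hinv.subset h
    exact le_antisymm hinv.card_le (hk.trans h1)

/-! ### The leaf search -/

theorem sum_biUnion_le {α β : Type*} [DecidableEq β] {g : β → ℝ} (hg : ∀ b, 0 ≤ g b)
    (s : Finset α) (t : α → Finset β) : ∑ b ∈ s.biUnion t, g b ≤ ∑ a ∈ s, ∑ b ∈ t a, g b := by
  classical
  induction s using Finset.induction_on with
  | empty => simp
  | insert a s ha ih =>
    rw [Finset.biUnion_insert, Finset.sum_insert ha]
    have h1 := Finset.sum_union_inter (s₁ := t a) (s₂ := s.biUnion t) (f := g)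
    have h2 : 0 ≤ ∑ b ∈ t a ∩ s.biUnion t, g b := Finset.sum_nonneg fun b _ => hg b
    linarith

theorem sum_le_sum_of_card_eq {α β : Type*} {s : Finset α} {t : Finset β} {f : α → ℝ} {g : β → ℝ}
    (h : s.card = t.card) (hfg : ∀ a ∈ s, ∀ b ∈ t, f a ≤ g b) : ∑ a ∈ s, f a ≤ ∑ b ∈ t, g b := by
  rw [← Finset.sum_coe_sort s f, ← Finset.sum_coe_sort t g,
    ← Equiv.sum_comp (Finset.equivOfCardEq h) fun b => g b]
  exact Finset.sum_le_sum fun a _ => hfg a a.2 _ (Finset.equivOfCardEq h a).2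

/-- One step of the leaf search from a single node. -/
noncomputable def stepDown {U : Type*} [Fintype U] {L : ℕ} (T : Finset (Node U L))
    (count : Node U L → ℝ) (v : Node U L) : Node U L :=
  open Classical in
  if h : (children T v).Nonempty then (exists_top_one count h).choose else v

theorem stepDown_of_children_eq {U : Type*} [Fintype U] {L : ℕ} {T : Finset (Node U L)}
    (count : Node U L → ℝ) {v : Node U L} (h : children T v = ∅) : stepDown T count v = v := by
  rw [stepDown, dif_neg (Finset.not_nonempty_iff_eq_empty.2 h)]

theorem stepDown_spec {U : Type*} [Fintype U] {L : ℕ} {T : Finset (Node U L)}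
    (count : Node U L → ℝ) {v : Node U L} (h : (children T v).Nonempty) :
    stepDown T count v ∈ children T v ∧ top count 1 (children T v) = {stepDown T count v} ∧
      ∀ w ∈ children T v, count w ≤ count (stepDown T count v) := by
  rw [stepDown, dif_pos h]
  exact (exists_top_one count h).choose_spec

open scoped Classical in
theorem descend_eq_image {U : Type*} [Fintype U] {L : ℕ} (T : Finset (Node U L))
    (count : Node U L → ℝ) (C : Finset (Node U L)) :
    descend T count C = C.image (stepDown T count) := by
  rw [descend, ← Finset.biUnion_singleton]
  refine Finset.biUnion_congr rfl fun v _ => ?_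
  by_cases h : children T v = ∅
  · rw [if_pos h, stepDown_of_children_eq count h]
  · rw [if_neg h, (stepDown_spec count (Finset.nonempty_iff_ne_empty.2 h)).2.1]

open scoped Classical in
theorem iterate_descend_eq_image {U : Type*} [Fintype U] {L : ℕ} (T : Finset (Node U L))
    (count : Node U L → ℝ) (C : Finset (Node U L)) (i : ℕ) :
    (descend T count)^[i] C = C.image ((stepDown T count)^[i]) := by
  induction i with
  | zero => simp
  | succ i ih =>
    rw [Function.iterate_succ_apply', ih, descend_eq_image, Finset.image_image,
      Function.iterate_succ']

open scoped Classical in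
theorem findLeaf_eq {U : Type*} [Fintype U] {L : ℕ} (T : Finset (Node U L))
    (count : Node U L → ℝ) (C : Finset (Node U L)) :
    findLeaf T count C = C.biUnion fun v => ((stepDown T count)^[L] v).2 := by
  rw [findLeaf, iterate_descend_eq_image, Finset.image_biUnion]

theorem stepDown_mem {U : Type*} [Fintype U] {L : ℕ} {T : Finset (Node U L)}
    (count : Node U L → ℝ) {v : Node U L} (hv : v ∈ T) :
    stepDown T count v ∈ T ∧ (stepDown T count v).2 ⊆ v.2 := by
  by_cases h : children T v = ∅
  · rw [stepDown_of_children_eq count h]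
    exact ⟨hv, subset_rfl⟩
  · have := mem_children.1 (stepDown_spec count (Finset.nonempty_iff_ne_empty.2 h)).1
    exact ⟨this.1, this.2.2⟩

theorem iterate_stepDown_mem {U : Type*} [Fintype U] {L : ℕ} {T : Finset (Node U L)}
    (count : Node U L → ℝ) {v : Node U L} (hv : v ∈ T) (i : ℕ) :
    (stepDown T count)^[i] v ∈ T ∧ ((stepDown T count)^[i] v).2 ⊆ v.2 := by
  induction i with
  | zero => exact ⟨hv, subset_rfl⟩
  | succ i ih =>
    rw [Function.iterate_succ_apply']
    have := stepDown_mem count ih.1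
    exact ⟨this.1, this.2.trans ih.2⟩

/-- Each step that is not idle lowers the level by one, and levels are at most `L`. -/
theorem iterate_stepDown_leaf {U : Type*} [Fintype U] {L : ℕ} {T : Finset (Node U L)}
    (count : Node U L → ℝ) (v : Node U L) :
    children T ((stepDown T count)^[L] v) = ∅ := by
  have key : ∀ i : ℕ, children T ((stepDown T count)^[i] v) = ∅ ∨
      (((stepDown T count)^[i] v).1 : ℕ) + i ≤ L := by
    intro i
    induction i with
    | zero => right; simpa using Nat.lt_succ_iff.1 v.1.2
    | succ i ih =>
      rw [Function.iterate_succ_apply']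
      set u := (stepDown T count)^[i] v
      by_cases h : children T u = ∅
      · left
        rw [stepDown_of_children_eq count h, h]
      · right
        have h1 := ih.resolve_left h
        have := mem_children.1 (stepDown_spec count (Finset.nonempty_iff_ne_empty.2 h)).1
        omega
  rcases key L with h | h
  · exact h
  · rw [← Finset.not_nonempty_iff_eq_empty]
    rintro ⟨w, hw⟩
    have := mem_children.1 hw
    omega

namespace IsHierarchy

variable {U : Type*} [Fintype U] [MetricSpace U] {L : ℕ} {T : Finset (Node U L)}

/-- The greedy path from a node ends at a single point; if the node has a point of `F`, then some
point of `F` in it is this end point, or leaves the greedy path at a node where the greedy child has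
no point of `F`. -/
theorem exists_leaf_point (hT : IsHierarchy T) (count : Node U L → ℝ) {c : Node U L}
    (hc : c ∈ T) : ∃ x, ((stepDown T count)^[L] c).2 = {x} ∧ x ∈ c.2 ∧
      ∀ F : Finset U, (∃ f ∈ F, f ∈ c.2) → ∃ f ∈ F, f ∈ c.2 ∧ (f = x ∨
        ∃ u ∈ T, ∃ v ∈ children T u, ∃ w ∈ children T u, x ∈ u.2 ∧ f ∈ v.2 ∧ x ∉ v.2 ∧
          w.2 ⊆ c.2 ∧ Disjoint w.2 F ∧ u.2 ⊆ c.2 ∧ count v ≤ count w) := by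
  obtain ⟨x, hx⟩ := hT.eq_singleton_of_children (iterate_stepDown_mem count hc L).1
    (iterate_stepDown_leaf count c)
  have hxi : ∀ j i : ℕ, i + j = L → x ∈ ((stepDown T count)^[i] c).2 := by
    intro j
    induction j with
    | zero => intro i hi; obtain rfl : i = L := hi; simp [hx]
    | succ j ih =>
      intro i hij
      have h1 := ih (i + 1) (by omega)
      rw [Function.iterate_succ_apply'] at h1
      exact (stepDown_mem count (iterate_stepDown_mem count hc i).1).2 h1
  refine ⟨x, hx, hxi L 0 (by omega), fun F hF => ?_⟩
  classical
  by_cases hxF : x ∈ F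
  · exact ⟨x, hxF, hxi L 0 (by omega), Or.inl rfl⟩
  have hex : ∃ i, Disjoint ((stepDown T count)^[i] c).2 F := ⟨L, by simpa [hx] using hxF⟩
  -- The first node of the greedy path that misses `F`. It is not `c`, so it has a predecessor `u`,
  -- which still contains a point of `F`; there the path turned away from that point.
  set m := Nat.find hex with hm
  have hmd : Disjoint ((stepDown T count)^[m] c).2 F := Nat.find_spec hex
  have hm0 : m ≠ 0 := by
    intro h0
    rw [h0] at hmd
    obtain ⟨f, hf, hfc⟩ := hF
    exact Finset.disjoint_left.1 hmd hfc hf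
  obtain ⟨i, hi⟩ := Nat.exists_eq_succ_of_ne_zero hm0
  have hiL : i + 1 ≤ L := by
    have : m ≤ L := Nat.find_min' hex (by simpa [hx] using hxF)
    omega
  have hlt : ¬ Disjoint ((stepDown T count)^[i] c).2 F := Nat.find_min hex (by omega)
  rw [hi, Function.iterate_succ_apply'] at hmd
  have hxu := hxi (L - i) i (by omega)
  have hxw := hxi (L - (i + 1)) (i + 1) (by omega)
  rw [Function.iterate_succ_apply'] at hxw
  obtain ⟨hu, huc⟩ := iterate_stepDown_mem (T := T) count hc i
  set u := (stepDown T count)^[i] c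
  have hne : (children T u).Nonempty := by
    rw [Finset.nonempty_iff_ne_empty]
    intro h0
    rw [stepDown_of_children_eq count h0] at hmd
    exact hlt hmd
  obtain ⟨hw, -, hmax⟩ := stepDown_spec count hne
  rw [Finset.not_disjoint_iff] at hlt
  obtain ⟨f, hfu, hfF⟩ := hlt
  obtain ⟨v, hv, hfv⟩ := hT.exists_child hu hne hfu
  refine ⟨f, hfF, huc hfu, Or.inr ⟨u, hu, v, hv, _, hw, hxu, hfv, ?_,
    ((mem_children.1 hw).2.2).trans huc, hmd, huc, hmax v hv⟩⟩
  intro hxv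
  have hv' := mem_children.1 hv
  have hw' := mem_children.1 hw
  have := hT.eq_of_mem hv'.1 hw'.1 hxv hxw (Fin.ext (by omega))
  exact Finset.disjoint_left.1 hmd (this ▸ hfv) hfF

/-- Held nodes form an antichain, hence are disjoint, and each contributes exactly one point. -/
theorem card_findLeaf (hT : IsHierarchy T) (count : Node U L → ℝ) {C : Finset (Node U L)}
    (hC : C ⊆ T) (hanti : ∀ v ∈ C, ∀ w ∈ C, ¬ IsDescendant w v) :
    (findLeaf T count C).card = C.card := by
  classical
  rw [findLeaf_eq, Finset.card_biUnion]
  · rw [Finset.card_eq_sum_ones]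
    refine Finset.sum_congr rfl fun v hv => ?_
    obtain ⟨x, hx, -⟩ := hT.exists_leaf_point count (hC hv)
    rw [hx, Finset.card_singleton]
  · intro v hv w hw hne
    exact (hT.disjoint_of_not_isDescendant (hC hv) (hC hw) hne (hanti w hw v hv)
      (hanti v hv w hw)).mono (iterate_stepDown_mem count (hC hv) L).2
        (iterate_stepDown_mem count (hC hw) L).2

end IsHierarchy

/-! ### The missed weight and the deterministic guarantee of the search -/

/-- The score of a node without noise. -/
noncomputable def trueScore {U : Type*} {L : ℕ} (D : Finset U) (v : Node U L) : ℝ :=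
  open Classical in
  ((D ∩ v.2).card : ℝ) * 2 ^ (v.1 : ℕ)

theorem trueScore_nonneg {U : Type*} {L : ℕ} (D : Finset U) (v : Node U L) :
    0 ≤ trueScore D v := by
  rw [trueScore]; positivity

/-- The total score of the nodes without a point of `F`. -/
noncomputable def missWeight {U : Type*} {L : ℕ} (T : Finset (Node U L)) (D F : Finset U) : ℝ :=
  open Classical in
  ∑ v ∈ T.filter (fun v => Disjoint v.2 F), trueScore D v

open scoped Classical in
theorem missWeight_eq_sum {U : Type*} {L : ℕ} (T : Finset (Node U L)) (D F : Finset U) :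
    missWeight T D F =
      ∑ p ∈ D, ∑ v ∈ T.filter (fun v => Disjoint v.2 F ∧ p ∈ v.2), (2 : ℝ) ^ (v.1 : ℕ) := by
  have h1 : ∀ p ∈ D, ∑ v ∈ T.filter (fun v => Disjoint v.2 F ∧ p ∈ v.2), (2 : ℝ) ^ (v.1 : ℕ) =
      ∑ v ∈ T.filter (fun v => Disjoint v.2 F), if p ∈ v.2 then (2 : ℝ) ^ (v.1 : ℕ) else 0 := by
    intro p _
    rw [← Finset.filter_filter, Finset.sum_filter]
  rw [Finset.sum_congr rfl h1, Finset.sum_comm, missWeight]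
  refine Finset.sum_congr rfl fun v _ => ?_
  rw [← Finset.sum_filter, Finset.sum_const, nsmul_eq_mul, trueScore, Finset.filter_mem_eq_inter]

namespace IsHierarchy

variable {U : Type*} [Fintype U] [MetricSpace U] {L : ℕ} {T : Finset (Node U L)}

/-- The highest node that contains `p` and misses `F`, and its parent. -/
theorem exists_highest_miss (hT : IsHierarchy T) {F : Finset U} (hF : F.Nonempty) {p : U}
    (hp : p ∉ F) : ∃ v ∈ T, p ∈ v.2 ∧ Disjoint v.2 F ∧
      (∀ w ∈ T, p ∈ w.2 → Disjoint w.2 F → w.1 ≤ v.1) ∧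
      ∃ w ∈ T, (w.1 : ℕ) = v.1 + 1 ∧ p ∈ w.2 ∧ ¬ Disjoint w.2 F := by
  classical
  obtain ⟨l, hl, -, hlp⟩ := hT.exists_leaf _ hT.root p (Finset.mem_univ p)
  obtain ⟨v, hv, hmax⟩ := Finset.exists_max_image
    (T.filter fun v => p ∈ v.2 ∧ Disjoint v.2 F) (fun v => v.1)
    ⟨l, Finset.mem_filter.2 ⟨hl, by rw [hlp]; simp, by rw [hlp]; simpa using hp⟩⟩
  rw [Finset.mem_filter] at hv
  have hlt : v.1 < Fin.last L := by
    refine lt_of_le_of_ne (Fin.le_last _) fun heq => ?_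
    have := hT.eq_of_mem hv.1 hT.root hv.2.1 (Finset.mem_univ p) heq
    obtain ⟨f, hf⟩ := hF
    have hd := hv.2.2
    rw [this] at hd
    exact Finset.disjoint_left.1 hd (Finset.mem_univ f) hf
  obtain ⟨w, hw, hw1, hw2⟩ := hT.parent v hv.1 hlt
  refine ⟨v, hv.1, hv.2.1, hv.2.2, fun w hw h1 h2 => hmax w (Finset.mem_filter.2 ⟨hw, h1, h2⟩),
    w, hw, hw1, hw2 hv.2.1, fun hd => ?_⟩
  have := hmax w (Finset.mem_filter.2 ⟨hw, hw2 hv.2.1, hd⟩)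
  rw [Fin.le_def] at this
  omega

/-- Charge a point `p` outside `F` to the highest node around it that misses `F`. If its level is
`h`, its parent contains a point of `F` and has diameter at most `2 ^ (h + 2)`, which explains the
factor 4. -/
theorem cost_le_missWeight (hT : IsHierarchy T) (D : Finset U) {F : Finset U} (hF : F.Nonempty) :
    cost F D ≤ 4 * missWeight T D F := by
  classical
  rw [cost, missWeight_eq_sum, Finset.mul_sum]
  refine Finset.sum_le_sum fun p _ => ?_
  by_cases hp : p ∈ F
  · rw [Metric.infDist_zero_of_mem (Finset.mem_coe.2 hp)]
    positivity
  obtain ⟨v, hv, hpv, hvF, -, w, hw, hw1, hpw, hwF⟩ := hT.exists_highest_miss hF hp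
  obtain ⟨f, hfw, hfF⟩ := Finset.not_disjoint_iff.1 hwF
  calc Metric.infDist p (F : Set U) ≤ dist p f :=
        Metric.infDist_le_dist_of_mem (Finset.mem_coe.2 hfF)
    _ ≤ 2 ^ ((w.1 : ℕ) + 1) := hT.dist_le w hw p hpw f hfw
    _ = 4 * 2 ^ (v.1 : ℕ) := by rw [hw1]; ring
    _ ≤ _ := by
      gcongr
      exact Finset.single_le_sum (f := fun v : Node U L => (2 : ℝ) ^ (v.1 : ℕ))
        (fun _ _ => by positivity) (Finset.mem_filter.2 ⟨hv, hvF, hpv⟩)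

/-- Along a chain of nodes the true scores add up geometrically. -/
theorem sum_trueScore_chain_le (hT : IsHierarchy T) (D : Finset U) {f : U} {v : Node U L}
    (hv : v ∈ T) (hfv : f ∈ v.2) {S : Finset (Node U L)} (hST : S ⊆ T)
    (hS : ∀ w ∈ S, f ∈ w.2 ∧ w.1 ≤ v.1) :
    ∑ w ∈ S, trueScore D w ≤ 2 * trueScore D v := by
  classical
  have h1 : ∀ w ∈ S, trueScore D w ≤ ((D ∩ v.2).card : ℝ) * 2 ^ (w.1 : ℕ) := by
    intro w hw
    rw [trueScore]
    gcongr
    exact hT.subset_of_mem (hST hw) hv (hS w hw).1 hfv (hS w hw).2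
  refine (Finset.sum_le_sum h1).trans ?_
  rw [← Finset.mul_sum]
  have h2 : ∑ w ∈ S, (2 : ℝ) ^ (w.1 : ℕ) ≤ ∑ j ∈ Finset.range ((v.1 : ℕ) + 1), (2 : ℝ) ^ j := by
    rw [← Finset.sum_image (s := S) (g := fun w : Node U L => (w.1 : ℕ)) (f := fun j => (2 : ℝ) ^ j)]
    · refine Finset.sum_le_sum_of_subset_of_nonneg ?_ fun _ _ _ => by positivity
      intro j hj
      obtain ⟨w, hw, rfl⟩ := Finset.mem_image.1 hj
      have := (hS w hw).2
      rw [Fin.le_def] at this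
      exact Finset.mem_range.2 (by omega)
    · intro a ha b hb hab
      exact hT.eq_of_mem (hST ha) (hST hb) (hS a ha).1 (hS b hb).1 (Fin.ext hab)
  have h3 : ∑ j ∈ Finset.range ((v.1 : ℕ) + 1), (2 : ℝ) ^ j ≤ 2 * 2 ^ (v.1 : ℕ) := by
    rw [geom_sum_eq (by norm_num)]
    rw [pow_succ]
    linarith
  calc _ ≤ ((D ∩ v.2).card : ℝ) * (2 * 2 ^ (v.1 : ℕ)) := by gcongr; exact h2.trans h3
    _ = _ := by rw [trueScore]; ring

/-- The weight missed by the output of the search, compared with that missed by any `k` centers;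
`M` bounds the noise of the scores. -/
theorem missWeight_findLeaf_le (hT : IsHierarchy T) (D : Finset U) (X : Node U L → ℝ) {M : ℝ}
    (hM : ∀ v ∈ T, |X v| * 2 ^ (v.1 : ℕ) ≤ M) {k : ℕ} (hk0 : 1 ≤ k) {C : Finset (Node U L)}
    (hC : SearchInvariant T (fun v => noisyCount D X v * 2 ^ (v.1 : ℕ)) k C) (hCk : C.card = k)
    {F : Finset U} (hF : F.card = k) :
    missWeight T D (findLeaf T (noisyCount D X) C) ≤ 3 * missWeight T D F + 4 * k * M := by
  classical
  set count := noisyCount D X with hcount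
  set G := findLeaf T count C with hG
  have hscore : ∀ v : Node U L, count v * 2 ^ (v.1 : ℕ) = trueScore D v + X v * 2 ^ (v.1 : ℕ) := by
    intro v
    rw [hcount, noisyCount, trueScore, add_mul]
  have hcomp : ∀ v ∈ T, ∀ w ∈ T, count v * 2 ^ (v.1 : ℕ) ≤ count w * 2 ^ (w.1 : ℕ) →
      trueScore D v ≤ trueScore D w + 2 * M := by
    intro v hv w hw h
    rw [hscore, hscore] at h
    have h1 := hM v hv
    have h2 := hM w hw
    have h3 : -(|X v| * 2 ^ (v.1 : ℕ)) ≤ X v * 2 ^ (v.1 : ℕ) := by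
      rw [← neg_mul]; gcongr; exact neg_abs_le _
    have h4 : X w * 2 ^ (w.1 : ℕ) ≤ |X w| * 2 ^ (w.1 : ℕ) := by
      gcongr; exact le_abs_self _
    linarith
  have hM0 : 0 ≤ M := le_trans (by positivity) (hM _ hT.root)
  have hdisj : ∀ c ∈ C, ∀ c' ∈ C, c ≠ c' → Disjoint c.2 c'.2 := fun c hc c' hc' hne =>
    hT.disjoint_of_not_isDescendant (hC.subset hc) (hC.subset hc') hne (hC.antichain c' hc' c hc)
      (hC.antichain c hc c' hc')
  have : Nonempty U := (Finset.card_pos.1 (by omega : 0 < F.card)).to_type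
  choose! pt hpt1 hpt2 hpt3 using fun (c : Node U L) (hc : c ∈ C) =>
    hT.exists_leaf_point count (hC.subset hc)
  have hptG : ∀ c ∈ C, pt c ∈ G := by
    intro c hc
    rw [hG, findLeaf_eq, Finset.mem_biUnion]
    exact ⟨c, hc, by rw [hpt1 c hc]; simp⟩
  have hGne : G.Nonempty := by
    obtain ⟨c, hc⟩ := Finset.card_pos.1 (by omega : 0 < C.card)
    exact ⟨_, hptG c hc⟩
  choose! top htop using fun (f : U) (hf : f ∉ G) => hT.exists_highest_miss hGne hf
  -- the nodes that miss the output have no higher score than the nodes that are held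
  have hle : ∀ v ∈ T, Disjoint v.2 G → ∀ c ∈ C, trueScore D v ≤ trueScore D c + 2 * M := by
    intro v hv hvG c hc
    have hno : ∀ w ∈ C, ¬ w.2 ⊆ v.2 := fun w hw hwv =>
      Finset.disjoint_left.1 hvG (hwv (hpt2 w hw)) (hptG w hw)
    exact hcomp v hv c (hC.subset hc) (hC.score_le c hc v hv (fun h => hno v h subset_rfl)
      fun w hw h => hno w hw h.2)
  -- The loss at `f`. No node around a point of `G` misses `G`, so the value there is zero.
  set t : U → ℝ := fun f => if f ∈ G then 0 else trueScore D (top f) with ht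
  -- `H` collects the held nodes that meet `F`, each matched with a point `g c` of `F` inside it.
  -- `E` collects the others, matched arbitrarily with the remaining points of `F`; the numbers
  -- agree because `F` and `C` both have `k` elements.
  have hmain : ∑ f ∈ F, t f ≤ missWeight T D F + 2 * k * M := by
    set H := C.filter fun c => ∃ f ∈ F, f ∈ c.2 with hH
    set E := C.filter fun c => ¬ ∃ f ∈ F, f ∈ c.2 with hE
    have hchoice : ∀ c ∈ H, ∃ f ∈ F, f ∈ c.2 ∧ ∃ w ∈ T, w.2 ⊆ c.2 ∧
        t f ≤ (if Disjoint w.2 F then trueScore D w else 0) + 2 * M ∧ w.2.Nonempty := by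
      intro c hc
      rw [hH, Finset.mem_filter] at hc
      obtain ⟨f, hf, hfc, hor⟩ := hpt3 c hc.1 F hc.2
      refine ⟨f, hf, hfc, ?_⟩
      rcases hor with rfl | ⟨u, hu, v, hv, w, hw, hxu, hfv, hxv, hwc, hwF, huc, hvw⟩
      · refine ⟨c, hC.subset hc.1, subset_rfl, ?_, hT.nonempty c (hC.subset hc.1)⟩
        rw [ht]
        simp only [if_pos (hptG c hc.1)]
        have : 0 ≤ (if Disjoint c.2 F then trueScore D c else 0) := by
          split_ifs
          · exact trueScore_nonneg _ _
          · exact le_rfl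
        linarith
      · have hv' := mem_children.1 hv
        have hw' := mem_children.1 hw
        refine ⟨w, hw'.1, hwc, ?_, hT.nonempty w hw'.1⟩
        rw [if_pos hwF]
        by_cases hfG : f ∈ G
        · rw [ht]
          simp only [if_pos hfG]
          have := trueScore_nonneg D w
          linarith
        · obtain ⟨h1, h2, h3, -, -⟩ := htop f hfG
          -- A node around `f` above the level of `v` contains `u`, hence the output point `pt c`,
          -- and so does not miss `G`.
          have hlev : (top f).1 ≤ v.1 := by
            by_contra! hlt
            have huv : u.1 ≤ (top f).1 := by
              rw [Fin.lt_def] at hlt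
              rw [Fin.le_def]
              omega
            have hsub := hT.subset_of_mem hu h1 (hv'.2.2 hfv) h2 huv
            exact Finset.disjoint_left.1 h3 (hsub hxu) (hptG c hc.1)
          have h5 : trueScore D (top f) ≤ trueScore D v := by
            rw [trueScore, trueScore]
            have := hT.subset_of_mem h1 hv'.1 h2 hfv hlev
            have hl : ((top f).1 : ℕ) ≤ v.1 := hlev
            gcongr
            norm_num
          have h6 : trueScore D v ≤ trueScore D w + 2 * M := by
            refine hcomp v hv'.1 w hw'.1 ?_
            have : (v.1 : ℕ) = w.1 := by omega
            rw [this]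
            gcongr
          rw [ht]
          simp only [if_neg hfG]
          exact h5.trans h6
    choose! g hgF hgc w hwT hwc hgw hwne using hchoice
    have hHC : H ⊆ C := Finset.filter_subset _ _
    have hEC : E ⊆ C := Finset.filter_subset _ _
    have hinj : Set.InjOn g (H : Set (Node U L)) := by
      intro c hc c' hc' heq
      by_contra hne
      exact Finset.disjoint_left.1 (hdisj c (hHC hc) c' (hHC hc') hne) (hgc c hc)
        (heq ▸ hgc c' hc')
    have himg : H.image g ⊆ F := Finset.image_subset_iff.2 hgF
    have hcardHE : H.card + E.card = C.card := Finset.card_filter_add_card_filter_not _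
    have hcard : (F \ H.image g).card = E.card := by
      rw [Finset.card_sdiff_of_subset himg, Finset.card_image_of_injOn hinj]
      omega
    have hsum1 : ∑ f ∈ F, t f = ∑ f ∈ F \ H.image g, t f + ∑ c ∈ H, t (g c) := by
      rw [← Finset.sum_sdiff himg, Finset.sum_image hinj]
    have hsum2 : ∑ f ∈ F \ H.image g, t f ≤ ∑ c ∈ E, (trueScore D c + 2 * M) := by
      refine sum_le_sum_of_card_eq hcard fun f _ c hc => ?_
      rw [ht]
      simp only
      split_ifs with hfG
      · have := trueScore_nonneg D c
        linarith
      · obtain ⟨h1, h2, h3, -, -⟩ := htop f hfG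
        exact hle _ h1 h3 c (hEC hc)
    have hsum3 : ∑ c ∈ H, t (g c) ≤
        ∑ c ∈ H, ((if Disjoint (w c).2 F then trueScore D (w c) else 0) + 2 * M) :=
      Finset.sum_le_sum fun c hc => hgw c hc
    have hEF : ∀ c ∈ E, Disjoint c.2 F := by
      intro c hc
      rw [hE, Finset.mem_filter] at hc
      rw [Finset.disjoint_left]
      exact fun x hx hxF => hc.2 ⟨x, hxF, hx⟩
    -- The node that pays for the point matched with `c`. It is nonempty and lies inside `c`, so
    -- different held nodes have different payers.
    set φ : Node U L → Node U L := fun c => if c ∈ E then c else w c with hφ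
    have hφT : ∀ c ∈ C, φ c ∈ T ∧ (φ c).2 ⊆ c.2 ∧ (φ c).2.Nonempty := by
      intro c hc
      rw [hφ]
      simp only
      split_ifs with hcE
      · exact ⟨hC.subset hc, subset_rfl, hT.nonempty c (hC.subset hc)⟩
      · have hcH : c ∈ H := by
          rw [hH, Finset.mem_filter]
          refine ⟨hc, ?_⟩
          by_contra h
          exact hcE (Finset.mem_filter.2 ⟨hc, h⟩)
        exact ⟨hwT c hcH, hwc c hcH, hwne c hcH⟩
    have hφinj : Set.InjOn φ (C : Set (Node U L)) := by
      intro c hc c' hc' heq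
      by_contra hne
      obtain ⟨-, h1, x, hx⟩ := hφT c hc
      obtain ⟨-, h2, -⟩ := hφT c' hc'
      exact Finset.disjoint_left.1 (hdisj c hc c' hc' hne) (h1 hx) (h2 (heq ▸ hx))
    have hsum4 : ∑ c ∈ C, (if Disjoint (φ c).2 F then trueScore D (φ c) else 0) ≤
        missWeight T D F := by
      rw [missWeight, Finset.sum_filter,
        ← Finset.sum_image (f := fun v : Node U L => if Disjoint v.2 F then trueScore D v else 0)
          hφinj]
      refine Finset.sum_le_sum_of_subset_of_nonneg
        (Finset.image_subset_iff.2 fun c hc => (hφT c hc).1) fun v _ _ => ?_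
      split_ifs
      · exact trueScore_nonneg _ _
      · exact le_rfl
    have hsum5 : ∑ c ∈ C, (if Disjoint (φ c).2 F then trueScore D (φ c) else 0) =
        ∑ c ∈ H, (if Disjoint (w c).2 F then trueScore D (w c) else 0) +
          ∑ c ∈ E, trueScore D c := by
      rw [← Finset.sum_filter_add_sum_filter_not C (fun c => ∃ f ∈ F, f ∈ c.2)]
      congr 1
      · refine Finset.sum_congr rfl fun c hc => ?_
        have : c ∉ E := fun h => (Finset.mem_filter.1 h).2 (Finset.mem_filter.1 hc).2
        simp only [hφ, if_neg this]
      · refine Finset.sum_congr rfl fun c hc => ?_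
        have hcE : c ∈ E := hc
        simp only [hφ, if_pos hcE, if_pos (hEF c hcE)]
    rw [Finset.sum_add_distrib, Finset.sum_const, nsmul_eq_mul] at hsum2 hsum3
    have hcast : (H.card : ℝ) + E.card = k := by
      rw [← hCk, ← hcardHE]; push_cast; ring
    have : (H.card : ℝ) * (2 * M) + E.card * (2 * M) = 2 * k * M := by rw [← hcast]; ring
    linarith
  -- split the nodes that miss the output according to whether they miss `F`
  have hsplit : missWeight T D G ≤ missWeight T D F + ∑ f ∈ F, 2 * t f := by
    have h1 : T.filter (fun v => Disjoint v.2 G) ⊆ T.filter (fun v => Disjoint v.2 F) ∪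
        F.biUnion fun f => T.filter fun v => Disjoint v.2 G ∧ f ∈ v.2 := by
      intro v hv
      rw [Finset.mem_filter] at hv
      rw [Finset.mem_union, Finset.mem_biUnion]
      by_cases h : Disjoint v.2 F
      · exact Or.inl (Finset.mem_filter.2 ⟨hv.1, h⟩)
      · obtain ⟨f, hfv, hfF⟩ := Finset.not_disjoint_iff.1 h
        exact Or.inr ⟨f, hfF, Finset.mem_filter.2 ⟨hv.1, hv.2, hfv⟩⟩
    have hnn : ∀ v : Node U L, 0 ≤ trueScore D v := trueScore_nonneg D
    calc missWeight T D G ≤ ∑ v ∈ T.filter (fun v => Disjoint v.2 F) ∪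
        F.biUnion (fun f => T.filter fun v => Disjoint v.2 G ∧ f ∈ v.2), trueScore D v :=
          Finset.sum_le_sum_of_subset_of_nonneg h1 fun v _ _ => hnn v
      _ ≤ missWeight T D F + ∑ v ∈ F.biUnion (fun f => T.filter fun v => Disjoint v.2 G ∧ f ∈ v.2),
          trueScore D v := by
        rw [missWeight, ← Finset.sum_union_inter]
        have : 0 ≤ ∑ v ∈ T.filter (fun v => Disjoint v.2 F) ∩
          F.biUnion (fun f => T.filter fun v => Disjoint v.2 G ∧ f ∈ v.2), trueScore D v :=
          Finset.sum_nonneg fun v _ => hnn v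
        linarith
      _ ≤ missWeight T D F + ∑ f ∈ F, ∑ v ∈ T.filter (fun v => Disjoint v.2 G ∧ f ∈ v.2),
          trueScore D v := by
        gcongr
        exact sum_biUnion_le hnn _ _
      _ ≤ _ := by
        gcongr with f hf
        rw [ht]
        simp only
        split_ifs with hfG
        · rw [Finset.filter_eq_empty_iff.2]
          · simp
          · intro v _ h
            exact Finset.disjoint_left.1 h.1 h.2 hfG
        · obtain ⟨h1, h2, h3, h4, -⟩ := htop f hfG
          refine hT.sum_trueScore_chain_le D h1 h2 (Finset.filter_subset _ _) fun v hv => ?_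
          rw [Finset.mem_filter] at hv
          exact ⟨hv.2.2, h4 v hv.1 hv.2.2 hv.2.1⟩
  -- The factor 2 of the geometric chains acts on `hmain`, giving `1 + 2 = 3` and `2 * 2 = 4`.
  rw [← Finset.mul_sum] at hsplit
  linarith

end IsHierarchy

/-! ### Ball partitions and the random tree -/

section Ball

variable {U : Type*} [Fintype U] [MetricSpace U] {π : U ≃ Fin (Fintype.card U)} {r : ℝ}
  {S S' S'' : Finset U}

theorem mem_ballCluster {u v : U} : u ∈ ballCluster π r S v ↔
    u ∈ S ∧ dist v u ≤ r ∧ ∀ v' ∈ S, π v' < π v → ¬ dist v' u ≤ r := by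
  simp only [ballCluster, Finset.mem_filter]

theorem mem_ballPartition : S' ∈ ballPartition π r S ↔
    (∃ v ∈ S, ballCluster π r S v = S') ∧ S'.Nonempty := by
  simp only [ballPartition, Finset.mem_filter, Finset.mem_image]

theorem subset_of_mem_ballPartition (h : S' ∈ ballPartition π r S) : S' ⊆ S := by
  obtain ⟨⟨v, -, rfl⟩, -⟩ := mem_ballPartition.1 h
  exact fun u hu => (mem_ballCluster.1 hu).1

theorem ballCluster_center_unique {u v v' : U} (hv : v ∈ S) (hv' : v' ∈ S)
    (h : u ∈ ballCluster π r S v) (h' : u ∈ ballCluster π r S v') : v = v' := by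
  rw [mem_ballCluster] at h h'
  rcases lt_trichotomy (π v) (π v') with hlt | heq | hlt
  · exact absurd h.2.1 (h'.2.2 v hv hlt)
  · exact π.injective heq
  · exact absurd h'.2.1 (h.2.2 v' hv' hlt)

theorem eq_of_mem_ballPartition (h' : S' ∈ ballPartition π r S) (h'' : S'' ∈ ballPartition π r S)
    {x : U} (hx : x ∈ S') (hx' : x ∈ S'') : S' = S'' := by
  obtain ⟨⟨v, hv, rfl⟩, -⟩ := mem_ballPartition.1 h'
  obtain ⟨⟨w, hw, rfl⟩, -⟩ := mem_ballPartition.1 h''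
  rw [ballCluster_center_unique hv hw hx hx']

/-- The center that takes the point `x`. -/
theorem exists_ballCluster (hr : 0 ≤ r) {x : U} (hx : x ∈ S) :
    ∃ v ∈ S, x ∈ ballCluster π r S v := by
  classical
  obtain ⟨v, hv, hmin⟩ := Finset.exists_min_image (S.filter fun v => dist v x ≤ r) π
    ⟨x, Finset.mem_filter.2 ⟨hx, by simpa using hr⟩⟩
  rw [Finset.mem_filter] at hv
  exact ⟨v, hv.1, mem_ballCluster.2 ⟨hx, hv.2, fun v' hv' hlt hd =>
    absurd (hmin v' (Finset.mem_filter.2 ⟨hv', hd⟩)) (not_le.2 hlt)⟩⟩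

theorem exists_mem_ballPartition (hr : 0 ≤ r) {x : U} (hx : x ∈ S) :
    ∃ S' ∈ ballPartition π r S, x ∈ S' := by
  obtain ⟨v, hv, hxv⟩ := exists_ballCluster (π := π) hr hx
  exact ⟨_, mem_ballPartition.2 ⟨⟨v, hv, rfl⟩, x, hxv⟩, hxv⟩

theorem dist_le_of_mem_ballPartition (h : S' ∈ ballPartition π r S) {x y : U} (hx : x ∈ S')
    (hy : y ∈ S') : dist x y ≤ 2 * r := by
  obtain ⟨⟨v, hv, rfl⟩, -⟩ := mem_ballPartition.1 h
  rw [mem_ballCluster] at hx hy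
  calc dist x y ≤ dist v x + dist v y := dist_triangle_left x y v
    _ ≤ 2 * r := by linarith [hx.2.1, hy.2.1]

theorem card_le_one_of_mem_ballPartition (hU : ∀ x y : U, x ≠ y → 1 ≤ dist x y) (hr : r < 1)
    (h : S' ∈ ballPartition π r S) : S'.card ≤ 1 := by
  obtain ⟨⟨v, hv, rfl⟩, -⟩ := mem_ballPartition.1 h
  have key : ∀ x ∈ ballCluster π r S v, v = x := by
    intro x hx
    by_contra hne
    linarith [hU v x hne, (mem_ballCluster.1 hx).2.1]
  exact Finset.card_le_one.2 fun x hx y hy => (key x hx).symm.trans (key y hy)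

end Ball

section Tree

variable {U : Type*} [Fintype U] [MetricSpace U] {L : ℕ} {τ : TreeSeed U L}

theorem mem_hst_succ {h : ℕ} {hh : h + 1 < L + 1} {S : Finset U} {v : Node U L} :
    v ∈ hst τ (h + 1) hh S ↔ v = (⟨h + 1, hh⟩, S) ∨ (1 < S.card ∧
      ∃ S' ∈ ballPartition (τ (⟨h, Nat.lt_of_succ_lt_succ hh⟩, S)).1
          ((τ (⟨h, Nat.lt_of_succ_lt_succ hh⟩, S)).2 * 2 ^ h) S,
        v ∈ hst τ h (Nat.lt_of_succ_lt hh) S') := by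
  classical
  rw [hst, Finset.mem_insert]
  split_ifs with hS
  · simp [not_lt.2 hS]
  · rw [Finset.mem_biUnion]
    simp [not_le.1 hS]

theorem mem_hst_zero {hh : 0 < L + 1} {S : Finset U} {v : Node U L} :
    v ∈ hst τ 0 hh S ↔ v = (⟨0, hh⟩, S) := by
  rw [hst, Finset.mem_singleton]

theorem root_mem_hst {h : ℕ} {hh : h < L + 1} {S : Finset U} : (⟨h, hh⟩, S) ∈ hst τ h hh S := by
  cases h with
  | zero => exact mem_hst_zero.2 rfl
  | succ h => exact mem_hst_succ.2 (Or.inl rfl)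

theorem hst_le {h : ℕ} {hh : h < L + 1} {S : Finset U} {v : Node U L}
    (hv : v ∈ hst τ h hh S) : (v.1 : ℕ) ≤ h ∧ v.2 ⊆ S := by
  induction h generalizing S with
  | zero => rw [mem_hst_zero.1 hv]; exact ⟨le_rfl, subset_rfl⟩
  | succ h ih =>
    rcases mem_hst_succ.1 hv with rfl | ⟨-, S', hS', hv⟩
    · exact ⟨le_rfl, subset_rfl⟩
    · obtain ⟨h1, h2⟩ := ih hv
      exact ⟨by omega, h2.trans (subset_of_mem_ballPartition hS')⟩

theorem hst_nonempty {h : ℕ} {hh : h < L + 1} {S : Finset U} (hS : S.Nonempty) {v : Node U L}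
    (hv : v ∈ hst τ h hh S) : v.2.Nonempty := by
  induction h generalizing S with
  | zero => rw [mem_hst_zero.1 hv]; exact hS
  | succ h ih =>
    rcases mem_hst_succ.1 hv with rfl | ⟨-, S', hS', hv⟩
    · exact hS
    · exact ih (mem_ballPartition.1 hS').2 hv

theorem hst_laminar {h : ℕ} {hh : h < L + 1} {S : Finset U} {v w : Node U L}
    (hv : v ∈ hst τ h hh S) (hw : w ∈ hst τ h hh S) (hvw : v.1 ≤ w.1) :
    v.2 ⊆ w.2 ∨ Disjoint v.2 w.2 := by
  induction h generalizing S with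
  | zero => rw [mem_hst_zero.1 hv, mem_hst_zero.1 hw]; exact Or.inl subset_rfl
  | succ h ih =>
    rcases mem_hst_succ.1 hw with rfl | ⟨-, S'', hS'', hw'⟩
    · exact Or.inl (hst_le hv).2
    rcases mem_hst_succ.1 hv with rfl | ⟨-, S', hS', hv'⟩
    · have := (hst_le hw').1
      rw [Fin.le_def] at hvw
      simp only at hvw
      omega
    by_cases heq : S' = S''
    · subst heq
      exact ih hv' hw'
    · right
      rw [Finset.disjoint_left]
      intro x hxv hxw
      exact heq (eq_of_mem_ballPartition hS' hS'' ((hst_le hv').2 hxv) ((hst_le hw').2 hxw))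

theorem hst_parent {h : ℕ} {hh : h < L + 1} {S : Finset U} {v : Node U L}
    (hv : v ∈ hst τ h hh S) :
    v = (⟨h, hh⟩, S) ∨ ∃ w ∈ hst τ h hh S, (w.1 : ℕ) = v.1 + 1 ∧ v.2 ⊆ w.2 := by
  induction h generalizing S with
  | zero => exact Or.inl (mem_hst_zero.1 hv)
  | succ h ih =>
    rcases mem_hst_succ.1 hv with rfl | ⟨hc, S', hS', hv'⟩
    · exact Or.inl rfl
    right
    rcases ih hv' with rfl | ⟨w, hw, hw1, hw2⟩
    · exact ⟨(⟨h + 1, hh⟩, S), root_mem_hst, rfl, subset_of_mem_ballPartition hS'⟩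
    · exact ⟨w, mem_hst_succ.2 (Or.inr ⟨hc, S', hS', hw⟩), hw1, hw2⟩

/-- The radius factors are in `[1/2, 1)`. -/
def GoodSeed (τ : TreeSeed U L) : Prop := ∀ i, (τ i).2 ∈ Set.Ico (1 / 2 : ℝ) 1

theorem hst_dist_le (hτ : GoodSeed τ) {h : ℕ} {hh : h < L + 1} {S : Finset U}
    (hS : ∀ x ∈ S, ∀ y ∈ S, dist x y ≤ 2 ^ (h + 1)) {v : Node U L} (hv : v ∈ hst τ h hh S) :
    ∀ x ∈ v.2, ∀ y ∈ v.2, dist x y ≤ 2 ^ ((v.1 : ℕ) + 1) := by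
  induction h generalizing S with
  | zero => rw [mem_hst_zero.1 hv]; exact hS
  | succ h ih =>
    rcases mem_hst_succ.1 hv with rfl | ⟨hc, S', hS', hv'⟩
    · exact hS
    refine ih (fun x hx y hy => (dist_le_of_mem_ballPartition hS' hx hy).trans ?_) hv'
    have := (hτ (⟨h, Nat.lt_of_succ_lt_succ hh⟩, S)).2
    rw [pow_succ, mul_comm ((2 : ℝ) ^ h)]
    have h2 : (0 : ℝ) < 2 ^ h := by positivity
    nlinarith

/-- A cluster that reaches level 0 from above has radius strictly less than 1, so it is a single
point because distinct points are at distance at least 1. This is why `GoodSeed` excludes the radius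
factor 1, a null event. -/
theorem hst_split (hU : ∀ x y : U, x ≠ y → 1 ≤ dist x y) (hτ : GoodSeed τ) {h : ℕ}
    {hh : h < L + 1} {S : Finset U} (hSne : S.Nonempty) (hS : h = 0 → S.card ≤ 1) {v : Node U L}
    (hv : v ∈ hst τ h hh S) : (∃ x, v.2 = {x}) ∨
      ∀ x ∈ v.2, ∃ w ∈ hst τ h hh S, (w.1 : ℕ) + 1 = v.1 ∧ w.2 ⊆ v.2 ∧ x ∈ w.2 := by
  have hone : ∀ S : Finset U, S.Nonempty → S.card ≤ 1 → ∃ x, S = {x} := fun S h1 h2 =>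
    Finset.card_eq_one.1 (le_antisymm h2 (Finset.card_pos.2 h1))
  induction h generalizing S with
  | zero => rw [mem_hst_zero.1 hv]; exact Or.inl (hone S hSne (hS rfl))
  | succ h ih =>
    have hg := hτ (⟨h, Nat.lt_of_succ_lt_succ hh⟩, S)
    rcases mem_hst_succ.1 hv with rfl | ⟨hc, S', hS', hv'⟩
    · by_cases hc : S.card ≤ 1
      · exact Or.inl (hone S hSne hc)
      right
      intro x hx
      obtain ⟨S', hS', hxS'⟩ := exists_mem_ballPartition
        (π := (τ (⟨h, Nat.lt_of_succ_lt_succ hh⟩, S)).1)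
        (r := (τ (⟨h, Nat.lt_of_succ_lt_succ hh⟩, S)).2 * 2 ^ h)
        (mul_nonneg (by linarith [hg.1]) (by positivity)) hx
      exact ⟨_, mem_hst_succ.2 (Or.inr ⟨not_le.1 hc, S', hS', root_mem_hst⟩), rfl,
        subset_of_mem_ballPartition hS', hxS'⟩
    · have h1 := ih (mem_ballPartition.1 hS').2 (by
        rintro rfl
        exact card_le_one_of_mem_ballPartition hU (by simpa using hg.2) hS') hv'
      refine h1.imp_right fun h2 x hx => ?_
      obtain ⟨w, hw, hw'⟩ := h2 x hx
      exact ⟨w, mem_hst_succ.2 (Or.inr ⟨hc, S', hS', hw⟩), hw'⟩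

theorem isHierarchy_hstTree [Nonempty U] (hU : ∀ x y : U, x ≠ y → 1 ≤ dist x y)
    (hdiam : ∀ x y : U, dist x y ≤ 2 ^ L) (hL : 1 ≤ L) (hτ : GoodSeed τ) :
    IsHierarchy (hstTree τ) where
  nonempty v hv := hst_nonempty Finset.univ_nonempty hv
  root := root_mem_hst
  laminar v hv w hw h := hst_laminar hv hw h
  parent v hv hlt := by
    rcases hst_parent hv with rfl | h
    · exact absurd hlt (lt_irrefl _)
    · exact h
  split v hv := hst_split hU hτ Finset.univ_nonempty (by omega) hv
  dist_le v hv := hst_dist_le hτ (fun x _ y _ => (hdiam x y).trans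
    (pow_le_pow_right₀ (by norm_num) (Nat.le_succ L))) hv

theorem cost_dpHst_le [Nonempty U] (hU : ∀ x y : U, x ≠ y → 1 ≤ dist x y)
    (hdiam : ∀ x y : U, dist x y ≤ 2 ^ L) (hL : 1 ≤ L) (hτ : GoodSeed τ) (D : Finset U)
    {k : ℕ} (hk : 1 ≤ k) (hkU : k ≤ Fintype.card U) (X : Node U L → ℝ) :
    (dpHst D k (τ, X)).card = k ∧
    ∀ {M : ℝ}, (∀ v ∈ hstTree τ, |X v| * 2 ^ (v.1 : ℕ) ≤ M) → ∀ {F : Finset U}, F.card = k →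
      cost (dpHst D k (τ, X)) D ≤ 12 * missWeight (hstTree τ) D F + 16 * k * M := by
  have hT := isHierarchy_hstTree hU hdiam hL hτ
  obtain ⟨hinv, hcard⟩ :=
    hT.subtreeSearch (fun v => noisyCount D X v * 2 ^ (v.1 : ℕ)) hkU
  have hC0 : (dpHst D k (τ, X)).card = k := by
    rw [dpHst, hT.card_findLeaf _ hinv.subset hinv.antichain, hcard]
  refine ⟨hC0, fun {M} hM {F} hF => ?_⟩
  have h1 := hT.cost_le_missWeight D (Finset.card_pos.1 (by omega : 0 < (dpHst D k (τ, X)).card))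
  have h2 := hT.missWeight_findLeaf_le D X hM hk hinv hcard hF
  have h3 : dpHst D k (τ, X) = findLeaf (hstTree τ) (noisyCount D X)
    (subtreeSearch (hstTree τ) (fun v => noisyCount D X v * 2 ^ (v.1 : ℕ)) k) := rfl
  rw [h3] at h1 ⊢
  linarith

end Tree

/-! ### Laplace noise -/

theorem integral_exp_neg_abs_div {c : ℝ} (hc : 0 < c) :
    ∫ x : ℝ, Real.exp (-|x| / c) = 2 * c := by
  rw [integral_comp_abs (f := fun x => Real.exp (-x / c))]
  have h : ∀ x : ℝ, -x / c = (-c⁻¹) * x := fun x => by ring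
  simp_rw [h]
  rw [integral_exp_mul_Ioi (by simpa using hc)]
  simp

/-- A function that is not integrable has integral zero by convention, so a nonzero integral
suffices. -/
theorem integrable_exp_neg_abs_div {c : ℝ} (hc : 0 < c) :
    Integrable fun x : ℝ => Real.exp (-|x| / c) :=
  Integrable.of_integral_ne_zero (by rw [integral_exp_neg_abs_div hc]; positivity)

theorem isProbabilityMeasure_laplace {b : ℝ} (hb : 0 < b) : IsProbabilityMeasure (laplace b) := by
  refine ⟨?_⟩
  rw [laplace, withDensity_apply _ MeasurableSet.univ, Measure.restrict_univ,
    ← ofReal_integral_eq_lintegral_ofReal ((integrable_exp_neg_abs_div hb).div_const _)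
      (Filter.Eventually.of_forall fun x => by positivity),
    integral_div, integral_exp_neg_abs_div hb, div_self (by positivity), ENNReal.ofReal_one]

/-- At half the critical rate, the weighted density is `exp (-|x| / (2 * b)) / (2 * b)`, whose mass
is 2. These moments control the maximum of the noise. -/
theorem laplace_exp_abs_div {b : ℝ} (hb : 0 < b) :
    Integrable (fun x => Real.exp (|x| / (2 * b))) (laplace b) ∧
      ∫ x, Real.exp (|x| / (2 * b)) ∂laplace b = 2 := by
  have hm : Measurable fun x : ℝ => ENNReal.ofReal (Real.exp (-|x| / b) / (2 * b)) := by
    fun_prop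
  have hfin : ∀ᵐ x : ℝ, ENNReal.ofReal (Real.exp (-|x| / b) / (2 * b)) < ⊤ :=
    Filter.Eventually.of_forall fun _ => ENNReal.ofReal_lt_top
  have heq : (fun x : ℝ => (ENNReal.ofReal (Real.exp (-|x| / b) / (2 * b))).toReal •
      Real.exp (|x| / (2 * b))) = fun x => Real.exp (-|x| / (2 * b)) / (2 * b) := by
    funext x
    rw [ENNReal.toReal_ofReal (by positivity), smul_eq_mul, div_mul_eq_mul_div, ← Real.exp_add]
    congr 2
    field_simp
    ring
  constructor
  · rw [laplace, integrable_withDensity_iff_integrable_smul' hm hfin, heq]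
    exact (integrable_exp_neg_abs_div (by positivity)).div_const _
  · rw [laplace, integral_withDensity_eq_integral_toReal_smul hm hfin, heq, integral_div,
      integral_exp_neg_abs_div (by positivity)]
    field_simp

theorem isProbabilityMeasure_noiseLaw (U : Type*) [Fintype U] (L : ℕ) {ε : ℝ} (hε : 0 < ε) :
    IsProbabilityMeasure (noiseLaw U L ε) := by
  have : ∀ v : Node U L, IsProbabilityMeasure (laplace (2 ^ (L - (v.1 : ℕ)) / ε)) := fun v =>
    isProbabilityMeasure_laplace (by positivity)
  rw [noiseLaw]
  infer_instance

theorem noiseLaw_exp_abs_div {U : Type*} [Fintype U] {L : ℕ} {ε : ℝ} (hε : 0 < ε)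
    (v : Node U L) :
    Integrable (fun X : Node U L → ℝ => Real.exp (|X v| / (2 * (2 ^ (L - (v.1 : ℕ)) / ε))))
      (noiseLaw U L ε) ∧
    ∫ X, Real.exp (|X v| / (2 * (2 ^ (L - (v.1 : ℕ)) / ε))) ∂noiseLaw U L ε = 2 := by
  have : ∀ v : Node U L, IsProbabilityMeasure (laplace (2 ^ (L - (v.1 : ℕ)) / ε)) := fun v =>
    isProbabilityMeasure_laplace (by positivity)
  obtain ⟨h1, h2⟩ := laplace_exp_abs_div (b := 2 ^ (L - (v.1 : ℕ)) / ε) (by positivity)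
  constructor
  · exact integrable_comp_eval (μ := fun v : Node U L => laplace (2 ^ (L - (v.1 : ℕ)) / ε))
      (i := v) h1
  · exact (integral_comp_eval (μ := fun v : Node U L => laplace (2 ^ (L - (v.1 : ℕ)) / ε))
      (i := v) h1.aestronglyMeasurable).trans h2

theorem cost_nonneg {U : Type*} [MetricSpace U] (F D : Finset U) : 0 ≤ cost F D :=
  Finset.sum_nonneg fun _ _ => Metric.infDist_nonneg

/-- The expected cost over the noise, for a fixed tree. -/
theorem integral_cost_dpHst_le {U : Type*} [Fintype U] [MetricSpace U] [Nonempty U] {L : ℕ}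
    {τ : TreeSeed U L} (hU : ∀ x y : U, x ≠ y → 1 ≤ dist x y)
    (hdiam : ∀ x y : U, dist x y ≤ 2 ^ L) (hL : 1 ≤ L) (hτ : GoodSeed τ) (D : Finset U)
    {k : ℕ} (hk : 1 ≤ k) (hkU : k ≤ Fintype.card U) {ε : ℝ} (hε : 0 < ε) {F : Finset U}
    (hF : F.card = k) :
    ∫ X, cost (dpHst D k (τ, X)) D ∂noiseLaw U L ε ≤ 12 * missWeight (hstTree τ) D F +
      16 * k * (2 ^ L / ε * (2 * Real.log (Fintype.card U * (L + 1)) + 4)) := by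
  have := isProbabilityMeasure_noiseLaw U L hε
  set N : ℝ := Fintype.card U * (L + 1) with hN
  have hN0 : 0 < N := by
    have : 0 < Fintype.card U := Fintype.card_pos
    positivity
  set b : ℝ := 2 ^ L / ε with hb
  have hb0 : 0 < b := by positivity
  set T := hstTree τ with hT
  have hTN : (T.card : ℝ) ≤ N := by
    have := (isHierarchy_hstTree hU hdiam hL hτ).card_le
    rw [hN]
    exact_mod_cast this
  set e : Node U L → (Node U L → ℝ) → ℝ := fun v X =>
    Real.exp (|X v| / (2 * (2 ^ (L - (v.1 : ℕ)) / ε))) with he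
  -- The threshold at which a union bound over `N` nodes becomes effective: `exp (-(t / (2 * b))) =
  -- 1 / N`.
  set t : ℝ := 2 * b * Real.log N with ht
  have hexp : Real.exp (-(t / (2 * b))) = N⁻¹ := by
    rw [ht, mul_div_cancel_left₀ _ (by positivity), Real.exp_neg, Real.exp_log hN0]
  have hbound : ∀ X : Node U L → ℝ, ∀ v ∈ T,
      |X v| * 2 ^ (v.1 : ℕ) ≤ t + 2 * b * N⁻¹ * ∑ w ∈ T, e w X := by
    intro X v hv
    have h1 : |X v| / (2 * (2 ^ (L - (v.1 : ℕ)) / ε)) = |X v| * 2 ^ (v.1 : ℕ) / (2 * b) := by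
      have h2 : (2 : ℝ) ^ (L - (v.1 : ℕ)) * 2 ^ (v.1 : ℕ) = 2 ^ L := by
        rw [← pow_add, Nat.sub_add_cancel (Nat.lt_succ_iff.1 v.1.2)]
      rw [hb, ← h2]
      field_simp
    -- The excess over `t` is bounded by `y ≤ exp y`. Replacing one exponential by the sum over all
    -- nodes gives a bound uniform in `v`, whose sum has expectation at most `2 * N`.
    have h3 : (|X v| * 2 ^ (v.1 : ℕ) - t) / (2 * b) ≤ N⁻¹ * e v X := by
      rw [he]
      simp only
      rw [h1, ← hexp, ← Real.exp_add]
      have : (|X v| * 2 ^ (v.1 : ℕ) - t) / (2 * b) =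
        -(t / (2 * b)) + |X v| * 2 ^ (v.1 : ℕ) / (2 * b) := by ring
      rw [this]
      linarith [Real.add_one_le_exp (-(t / (2 * b)) + |X v| * 2 ^ (v.1 : ℕ) / (2 * b))]
    have h4 : e v X ≤ ∑ w ∈ T, e w X :=
      Finset.single_le_sum (f := fun w => e w X) (fun w _ => (Real.exp_pos _).le) hv
    rw [div_le_iff₀ (by positivity)] at h3
    have h5 : N⁻¹ * e v X * (2 * b) ≤ N⁻¹ * (∑ w ∈ T, e w X) * (2 * b) := by gcongr
    linarith
  have hint : ∀ v, Integrable (e v) (noiseLaw U L ε) := fun v => (noiseLaw_exp_abs_div hε v).1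
  have hsum : Integrable (fun X => ∑ w ∈ T, e w X) (noiseLaw U L ε) :=
    integrable_finsetSum _ fun v _ => hint v
  have hI : ∫ X, ∑ w ∈ T, e w X ∂noiseLaw U L ε = T.card * 2 := by
    rw [integral_finsetSum _ fun v _ => hint v,
      Finset.sum_congr rfl fun v _ => (noiseLaw_exp_abs_div hε v).2, Finset.sum_const, nsmul_eq_mul]
  have hrhs : Integrable (fun X => t + 2 * b * N⁻¹ * ∑ w ∈ T, e w X) (noiseLaw U L ε) :=
    (integrable_const _).add (hsum.const_mul _)
  calc ∫ X, cost (dpHst D k (τ, X)) D ∂noiseLaw U L ε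
      ≤ ∫ X, (12 * missWeight T D F + 16 * k * (t + 2 * b * N⁻¹ * ∑ w ∈ T, e w X))
          ∂noiseLaw U L ε :=
        integral_mono_of_nonneg (Filter.Eventually.of_forall fun X => cost_nonneg _ _)
          ((integrable_const _).add (hrhs.const_mul _))
          (Filter.Eventually.of_forall fun X =>
            (cost_dpHst_le hU hdiam hL hτ D hk hkU X).2 (hbound X) hF)
    _ = 12 * missWeight T D F + 16 * k * (t + 2 * b * N⁻¹ * (T.card * 2)) := by
        rw [integral_add (integrable_const _) (hrhs.const_mul _),
          integral_const_mul (16 * (k : ℝ)),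
          integral_add (integrable_const _) (hsum.const_mul _), integral_const_mul (2 * b * N⁻¹), hI]
        simp
    _ ≤ _ := by
        have h6 : N⁻¹ * T.card ≤ 1 := by
          rw [inv_mul_le_iff₀ hN0]; linarith
        have h7 : 2 * b * N⁻¹ * (T.card * 2) ≤ 4 * b := by
          have : 2 * b * N⁻¹ * (T.card * 2) = 4 * b * (N⁻¹ * T.card) := by ring
          rw [this]
          nlinarith
        have h8 : t + 2 * b * N⁻¹ * (T.card * 2) ≤ b * (2 * Real.log N + 4) := by
          rw [ht]; linarith
        gcongr

/-! ### Measurability of the algorithm -/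

/-- Measurability of a map to a finite set without structure: all fibers are measurable. -/
def FiberMeasurable {Ω α : Type*} [MeasurableSpace Ω] (f : Ω → α) : Prop :=
  ∀ a, MeasurableSet (f ⁻¹' {a})

namespace FiberMeasurable

variable {Ω α β : Type*} [MeasurableSpace Ω] [Finite α]

theorem preimage {f : Ω → α} (hf : FiberMeasurable f) (s : Set α) : MeasurableSet (f ⁻¹' s) := by
  rw [← Set.biUnion_of_singleton s, Set.preimage_iUnion₂]
  exact MeasurableSet.biUnion s.to_countable fun a _ => hf a

theorem comp {f : Ω → α} (hf : FiberMeasurable f) (g : α → β) :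
    FiberMeasurable fun ω => g (f ω) := fun b => hf.preimage (g ⁻¹' {b})

theorem measurable {f : Ω → α} (hf : FiberMeasurable f) [MeasurableSpace β] (g : α → β) :
    Measurable fun ω => g (f ω) := fun s _ => hf.preimage (g ⁻¹' s)

/-- On each of the finitely many fibers of `f` the inner map is fixed. Thus a random tree or a
random set of held nodes can be frozen while the next stage is treated. -/
theorem bind {f : Ω → α} (hf : FiberMeasurable f) {g : α → Ω → β}
    (hg : ∀ a, FiberMeasurable (g a)) : FiberMeasurable fun ω => g (f ω) ω := by
  intro b
  have : (fun ω => g (f ω) ω) ⁻¹' {b} = ⋃ a, f ⁻¹' {a} ∩ g a ⁻¹' {b} := by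
    ext ω
    simp
  rw [this]
  exact MeasurableSet.iUnion fun a => (hf a).inter (hg a b)

theorem const (b : β) : FiberMeasurable fun _ : Ω => b := fun a =>
  MeasurableSet.const (b = a)

omit [Finite α] in
theorem comp_measurable {Ω' : Type*} [MeasurableSpace Ω'] {f : Ω → α} (hf : FiberMeasurable f)
    {g : Ω' → Ω} (hg : Measurable g) : FiberMeasurable fun ω => f (g ω) := fun a => hg (hf a)

omit [Finite α] in
theorem pi {ι : Type*} [Finite ι] {f : ι → Ω → α} (hf : ∀ i, FiberMeasurable (f i)) :
    FiberMeasurable fun ω i => f i ω := by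
  intro a
  have : (fun ω i => f i ω) ⁻¹' {a} = ⋂ i, f i ⁻¹' {a i} := by
    ext ω
    simp [funext_iff]
  rw [this]
  exact MeasurableSet.iInter fun i => hf i (a i)

omit [Finite α] in
theorem filter {S : Finset α} {p : Ω → α → Prop} [∀ ω, DecidablePred (p ω)]
    (hp : ∀ a ∈ S, MeasurableSet {ω | p ω a}) : FiberMeasurable fun ω => S.filter (p ω) := by
  intro A
  have : (fun ω => S.filter (p ω)) ⁻¹' {A} =
      {_ω | A ⊆ S} ∩ ⋂ a ∈ S, {ω | p ω a ↔ a ∈ A} := by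
    ext ω
    simp only [Set.mem_preimage, Set.mem_singleton_iff, Finset.ext_iff, Finset.mem_filter,
      Set.mem_inter_iff, Set.mem_ofPred_eq, Set.mem_iInter]
    constructor
    · intro h
      exact ⟨fun a ha => ((h a).2 ha).1, fun a ha => by rw [← h a]; simp [ha]⟩
    · rintro ⟨h1, h2⟩ a
      constructor
      · rintro ⟨h3, h4⟩
        exact (h2 a h3).1 h4
      · intro h3
        exact ⟨h1 h3, (h2 a (h1 h3)).2 h3⟩
  rw [this]
  refine (MeasurableSet.const _).inter (Finset.measurableSet_biInter S fun a ha => ?_)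
  by_cases h : a ∈ A
  · simp only [h, iff_true]
    exact hp a ha
  · simp only [h, iff_false]
    exact (hp a ha).compl

end FiberMeasurable

section Search

variable {Ω U : Type*} [MeasurableSpace Ω] [Fintype U] {L : ℕ}

theorem fiberMeasurable_top {f : Ω → Node U L → ℝ} (hf : ∀ v, Measurable fun ω => f ω v) (j : ℕ)
    (S : Finset (Node U L)) : FiberMeasurable fun ω => top (f ω) j S := by
  classical
  simp only [top]
  refine FiberMeasurable.filter fun v _ => ?_
  have h : FiberMeasurable fun ω => S.filter fun w => f ω v < f ω w ∨
      (f ω w = f ω v ∧ Fintype.equivFin (Node U L) w < Fintype.equivFin (Node U L) v) := by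
    refine FiberMeasurable.filter fun w _ => ?_
    exact (measurableSet_lt (hf v) (hf w)).union
      ((measurableSet_eq_fun (hf w) (hf v)).inter (MeasurableSet.const _))
  exact h.preimage {A | A.card < j}

theorem fiberMeasurable_subtreeSearch (T : Finset (Node U L)) {f : Ω → Node U L → ℝ}
    (hf : ∀ v, Measurable fun ω => f ω v) (k : ℕ) :
    FiberMeasurable fun ω => subtreeSearch T (f ω) k := by
  classical
  have hround : ∀ C, FiberMeasurable fun ω => subtreeRound T (f ω) k C := by
    intro C
    by_cases hC : C.card < k
    · simp only [subtreeRound, if_pos hC]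
      exact (fiberMeasurable_top hf (k - C.card) _).comp fun N =>
        (C ∪ N).filter fun v => ¬ ∃ w ∈ C ∪ N, IsDescendant w v
    · simp only [subtreeRound, if_neg hC]
      exact FiberMeasurable.const C
  have hiter : ∀ i : ℕ, FiberMeasurable fun ω => (subtreeRound T (f ω) k)^[i] ∅ := by
    intro i
    induction i with
    | zero => exact FiberMeasurable.const ∅
    | succ i ih =>
      simp only [Function.iterate_succ_apply']
      exact ih.bind hround
  exact hiter T.card

theorem fiberMeasurable_findLeaf (T : Finset (Node U L)) {f : Ω → Node U L → ℝ}
    (hf : ∀ v, Measurable fun ω => f ω v) (C : Finset (Node U L)) :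
    FiberMeasurable fun ω => findLeaf T (f ω) C := by
  classical
  have hdescend : ∀ C, FiberMeasurable fun ω => descend T (f ω) C := by
    intro C
    simp only [descend]
    exact (FiberMeasurable.pi fun v => fiberMeasurable_top hf 1 (children T v)).comp
      fun t : Node U L → Finset (Node U L) =>
        C.biUnion fun v => if children T v = ∅ then {v} else t v
  have hiter : ∀ i : ℕ, FiberMeasurable fun ω => (descend T (f ω))^[i] C := by
    intro i
    induction i with
    | zero => exact FiberMeasurable.const C
    | succ i ih =>
      simp only [Function.iterate_succ_apply']
      exact ih.bind hdescend
  simp only [findLeaf]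
  exact (hiter L).comp fun A => A.biUnion fun v => v.2

end Search

section Tree

variable {U : Type*} [Fintype U] [MetricSpace U] {L : ℕ}

theorem fiberMeasurable_ballPartition (c : ℝ) (S : Finset U) :
    FiberMeasurable fun a : PointOrder U × ℝ => ballPartition a.1 (a.2 * c) S := by
  classical
  have hd : ∀ v u : U, MeasurableSet {a : PointOrder U × ℝ | dist v u ≤ a.2 * c} := fun v u =>
    measurableSet_le measurable_const (measurable_snd.mul_const c)
  have hπ : ∀ v v' : U, MeasurableSet {a : PointOrder U × ℝ |
      DFunLike.coe (F := U ≃ Fin (Fintype.card U)) a.1 v' <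
        DFunLike.coe (F := U ≃ Fin (Fintype.card U)) a.1 v} := fun v v' =>
    (measurable_fst : Measurable (Prod.fst : PointOrder U × ℝ → PointOrder U))
      (show MeasurableSet {π : PointOrder U |
        DFunLike.coe (F := U ≃ Fin (Fintype.card U)) π v' <
          DFunLike.coe (F := U ≃ Fin (Fintype.card U)) π v} from trivial)
  have h : ∀ v, FiberMeasurable fun a : PointOrder U × ℝ => ballCluster a.1 (a.2 * c) S v := by
    intro v
    simp only [ballCluster]
    refine FiberMeasurable.filter fun u _ => (hd v u).inter ?_
    change MeasurableSet {a : PointOrder U × ℝ | ∀ v' ∈ S,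
      DFunLike.coe (F := U ≃ Fin (Fintype.card U)) a.1 v' <
        DFunLike.coe (F := U ≃ Fin (Fintype.card U)) a.1 v → ¬ dist v' u ≤ a.2 * c}
    simp only [Set.ofPred_forall]
    exact MeasurableSet.iInter fun v' => MeasurableSet.iInter fun _ =>
      (hπ v v').imp (hd v' u).compl
  simp only [ballPartition]
  exact (FiberMeasurable.pi h).comp fun t : U → Finset U => (S.image t).filter Finset.Nonempty

theorem fiberMeasurable_hst (h : ℕ) (hh : h < L + 1) (S : Finset U) :
    FiberMeasurable fun τ : TreeSeed U L => hst τ h hh S := by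
  classical
  induction h generalizing S with
  | zero =>
    simp only [hst]
    exact FiberMeasurable.const _
  | succ h ih =>
    simp only [hst]
    by_cases hS : S.card ≤ 1
    · simp only [if_pos hS]
      exact FiberMeasurable.const _
    simp only [if_neg hS]
    refine ((fiberMeasurable_ballPartition (2 ^ h) S).comp_measurable
      (measurable_pi_apply (⟨h, Nat.lt_of_succ_lt_succ hh⟩, S))).bind
      (g := fun P (τ : TreeSeed U L) => insert (⟨h + 1, hh⟩, S)
        (P.biUnion fun S' => hst τ h (Nat.lt_of_succ_lt hh) S')) fun P => ?_
    exact (FiberMeasurable.pi fun S' => ih (Nat.lt_of_succ_lt hh) S').comp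
      fun t : Finset U → Finset (Node U L) => insert (⟨h + 1, hh⟩, S) (P.biUnion t)

theorem fiberMeasurable_hstTree : FiberMeasurable fun τ : TreeSeed U L => hstTree τ :=
  fiberMeasurable_hst L _ _

theorem fiberMeasurable_dpHst (D : Finset U) (k : ℕ) :
    FiberMeasurable fun ω : TreeSeed U L × (Node U L → ℝ) => dpHst D k ω := by
  classical
  have hc : ∀ v : Node U L,
      Measurable fun ω : TreeSeed U L × (Node U L → ℝ) => noisyCount D ω.2 v := fun v => by
    simp only [noisyCount]
    exact measurable_const.add ((measurable_pi_apply v).comp measurable_snd)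
  simp only [dpHst]
  refine (fiberMeasurable_hstTree.comp_measurable measurable_fst).bind
    (g := fun T (ω : TreeSeed U L × (Node U L → ℝ)) => findLeaf T (noisyCount D ω.2)
      (subtreeSearch T (fun v => noisyCount D ω.2 v * 2 ^ (v.1 : ℕ)) k)) fun T => ?_
  exact (fiberMeasurable_subtreeSearch T (fun v => (hc v).mul_const _) k).bind
    (g := fun C (ω : TreeSeed U L × (Node U L → ℝ)) => findLeaf T (noisyCount D ω.2) C)
    fun C => fiberMeasurable_findLeaf T hc C

end Tree

/-! ### Harmonic sums over ranks -/

/-- If `Q` is listed by increasing `m`, the `j`-th term is at most `1 / (c + j)`; ties only enlarge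
the ranks. The induction inserts a point of largest value, whose term is exactly the last one. -/
theorem sum_inv_card_le_harmonic {α : Type*} [DecidableEq α] (m : α → ℝ) (c : ℕ) (Q : Finset α) :
    ∑ v ∈ Q, ((c + (Q.filter fun u => m u ≤ m v).card : ℕ) : ℝ)⁻¹ ≤
      (harmonic (c + Q.card) : ℝ) - harmonic c := by
  classical
  induction Q using Finset.induction_on_max_value m with
  | empty => simp
  | insert a s ha hmax ih =>
    rw [Finset.sum_insert ha, Finset.card_insert_of_notMem ha, ← add_assoc, harmonic_succ]
    have h1 : (insert a s).filter (fun u => m u ≤ m a) = insert a s :=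
      Finset.filter_true_of_mem fun u hu => by
        rcases Finset.mem_insert.1 hu with rfl | hu
        · exact le_rfl
        · exact hmax u hu
    rw [h1, Finset.card_insert_of_notMem ha]
    have h2 : ∑ v ∈ s, ((c + ((insert a s).filter fun u => m u ≤ m v).card : ℕ) : ℝ)⁻¹ ≤
        ∑ v ∈ s, ((c + (s.filter fun u => m u ≤ m v).card : ℕ) : ℝ)⁻¹ := by
      refine Finset.sum_le_sum fun v hv => inv_anti₀ ?_ ?_
      · have : 0 < (s.filter fun u => m u ≤ m v).card :=
          Finset.card_pos.2 ⟨v, Finset.mem_filter.2 ⟨hv, le_rfl⟩⟩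
        exact_mod_cast (by omega)
      · have := Finset.card_le_card
          (Finset.filter_subset_filter (fun u => m u ≤ m v) (Finset.subset_insert a s))
        exact_mod_cast (by omega)
    push_cast at h2 ih ⊢
    rw [← add_assoc]
    linarith

/-- The number of points of `S` at which `m` is at most `r`. -/
noncomputable def countLe {α : Type*} (m : α → ℝ) (S : Finset α) (r : ℝ) : ℕ :=
  open Classical in (S.filter fun u => m u ≤ r).card

theorem countLe_mono {α : Type*} (m : α → ℝ) {S S' : Finset α} (h : S ⊆ S') (r : ℝ) :
    countLe m S r ≤ countLe m S' r :=
  Finset.card_le_card (Finset.filter_subset_filter _ h)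

-- The points with `m ≤ a` precede those in the window `(a, b]`, so they shift every rank in the
-- window by their number.
open scoped Classical in
theorem sum_inv_countLe_le {α : Type*} (m : α → ℝ) (S : Finset α) {a b : ℝ} (hab : a ≤ b) :
    ∑ v ∈ S.filter (fun v => a < m v ∧ m v ≤ b), (countLe m S (m v) : ℝ)⁻¹ ≤
      (harmonic (countLe m S b) : ℝ) - harmonic (countLe m S a) := by
  set Q := S.filter fun v => a < m v ∧ m v ≤ b with hQ
  have hb : countLe m S b = countLe m S a + Q.card := by
    rw [countLe, countLe, ← Finset.card_union_of_disjoint]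
    · congr 1
      ext u
      simp only [hQ, Finset.mem_union, Finset.mem_filter, ← and_or_left]
      refine and_congr_right fun _ => ⟨fun h => ?_, ?_⟩
      · rcases le_or_gt (m u) a with h' | h'
        · exact Or.inl h'
        · exact Or.inr ⟨h', h⟩
      · rintro (h | h)
        · exact h.trans hab
        · exact h.2
    · rw [Finset.disjoint_left]
      intro u hu hu'
      rw [hQ, Finset.mem_filter] at hu'
      exact absurd (Finset.mem_filter.1 hu).2 (not_le.2 hu'.2.1)
  rw [hb]
  refine (Finset.sum_le_sum fun v hv => ?_).trans (sum_inv_card_le_harmonic m (countLe m S a) Q)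
  have hv' := hv
  rw [hQ, Finset.mem_filter] at hv'
  refine inv_anti₀ ?_ ?_
  · have : 0 < (Q.filter fun u => m u ≤ m v).card :=
      Finset.card_pos.2 ⟨v, Finset.mem_filter.2 ⟨hv, le_rfl⟩⟩
    exact_mod_cast (by omega)
  · have : countLe m S a + (Q.filter fun u => m u ≤ m v).card ≤ countLe m S (m v) := by
      rw [countLe, countLe, ← Finset.card_union_of_disjoint]
      · refine Finset.card_le_card fun u hu => ?_
        rcases Finset.mem_union.1 hu with hu | hu
        · rw [Finset.mem_filter] at hu ⊢
          exact ⟨hu.1, hu.2.trans hv'.2.1.le⟩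
        · rw [Finset.mem_filter, hQ, Finset.mem_filter] at hu
          exact Finset.mem_filter.2 ⟨hu.1.1, hu.2⟩
      · rw [Finset.disjoint_left]
        intro u hu hu'
        rw [hQ, Finset.mem_filter, Finset.mem_filter] at hu'
        exact absurd (Finset.mem_filter.1 hu).2 (not_le.2 hu'.1.2.1)
    exact_mod_cast this

theorem harmonic_mono {m n : ℕ} (h : m ≤ n) : (harmonic m : ℝ) ≤ harmonic n := by
  have : harmonic m ≤ harmonic n := Finset.sum_le_sum_of_subset_of_nonneg
    (Finset.range_subset_range.2 h) fun _ _ _ => by positivity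
  exact_mod_cast this

/-! ### Resampling and the law of one split -/

/-- Resampling one coordinate of a product measure. -/
theorem lintegral_pi_update {ι : Type*} [Fintype ι] [DecidableEq ι] {X : ι → Type*}
    [∀ i, MeasurableSpace (X i)] (μ : ∀ i, Measure (X i)) [∀ i, IsProbabilityMeasure (μ i)]
    (i : ι) {f : (∀ i, X i) → ENNReal} (hf : Measurable f) :
    ∫⁻ τ, f τ ∂Measure.pi μ = ∫⁻ a, ∫⁻ τ, f (Function.update τ i a) ∂Measure.pi μ ∂μ i := by
  have hm : Measurable fun p : X i × (∀ i, X i) => Function.update p.2 i p.1 :=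
    measurable_update'.comp measurable_swap
  -- Replacing a coordinate by an independent copy preserves the product law, which is checked on
  -- boxes.
  have hmap : Measure.pi μ = ((μ i).prod (Measure.pi μ)).map
      fun p : X i × (∀ i, X i) => Function.update p.2 i p.1 := by
    refine Measure.pi_eq fun s hs => ?_
    rw [Measure.map_apply hm (MeasurableSet.univ_pi hs)]
    have : (fun p : X i × (∀ i, X i) => Function.update p.2 i p.1) ⁻¹' Set.univ.pi s =
        s i ×ˢ Set.univ.pi (Function.update s i Set.univ) := by
      ext p
      simp only [Set.mem_preimage, Set.mem_univ_pi, Set.mem_prod]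
      constructor
      · intro h
        refine ⟨by simpa using h i, fun j => ?_⟩
        by_cases hj : j = i
        · subst hj; simp
        · simpa [hj] using h j
      · rintro ⟨h1, h2⟩ j
        by_cases hj : j = i
        · subst hj; simpa using h1
        · simpa [hj] using h2 j
    rw [this, Measure.prod_prod, Measure.pi_pi, ← Finset.mul_prod_erase _ _ (Finset.mem_univ i),
      ← Finset.mul_prod_erase _ (fun j => μ j (s j)) (Finset.mem_univ i)]
    simp only [Function.update_self, measure_univ, one_mul]
    congr 1
    refine Finset.prod_congr rfl fun j hj => ?_
    rw [Function.update_of_ne (Finset.ne_of_mem_erase hj)]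
  conv_lhs => rw [hmap, lintegral_map hf hm]
  exact lintegral_prod _ (hf.comp hm).aemeasurable

theorem lintegral_pi_le_update {ι : Type*} [Fintype ι] [DecidableEq ι] {X : ι → Type*}
    [∀ i, MeasurableSpace (X i)] (μ : ∀ i, Measure (X i)) [∀ i, IsProbabilityMeasure (μ i)]
    (i : ι) {f : (∀ i, X i) → ENNReal} (hf : Measurable f) {g : X i → ENNReal}
    (h : ∀ᵐ a ∂μ i, ∫⁻ τ, f (Function.update τ i a) ∂Measure.pi μ ≤ g a) :
    ∫⁻ τ, f τ ∂Measure.pi μ ≤ ∫⁻ a, g a ∂μ i := by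
  rw [lintegral_pi_update μ i hf]
  exact lintegral_mono_ae h

section Law

variable (U : Type*) [Fintype U]

noncomputable instance : Fintype (PointOrder U) :=
  open Classical in inferInstanceAs (Fintype (U ≃ Fin (Fintype.card U)))

noncomputable instance : Nonempty (PointOrder U) :=
  ⟨(Fintype.equivFin U : U ≃ Fin (Fintype.card U))⟩

instance : MeasurableSingletonClass (PointOrder U) := ⟨fun _ => trivial⟩

instance : IsProbabilityMeasure (uniformOn (Set.univ : Set (PointOrder U))) :=
  isProbabilityMeasure_uniformOn Set.finite_univ Set.univ_nonempty

instance : IsProbabilityMeasure ((volume : Measure ℝ)[|Set.Icc (1 / 2 : ℝ) 1]) :=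
  cond_isProbabilityMeasure_of_finite (by rw [Real.volume_Icc]; norm_num)
    (by rw [Real.volume_Icc]; exact ENNReal.ofReal_ne_top)

/-- The law of an ordering and a radius factor. -/
noncomputable def splitLaw : Measure (PointOrder U × ℝ) :=
  (uniformOn (Set.univ : Set (PointOrder U))).prod ((volume : Measure ℝ)[|Set.Icc (1 / 2 : ℝ) 1])

instance : IsProbabilityMeasure (splitLaw U) := by
  rw [splitLaw]; infer_instance

theorem treeSeedLaw_eq (L : ℕ) :
    treeSeedLaw U L = Measure.pi fun _ : Fin L × Finset U => splitLaw U := rfl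

instance (L : ℕ) : IsProbabilityMeasure (treeSeedLaw U L) := by
  rw [treeSeedLaw_eq]; infer_instance

variable {U}

/-- A given point of `B` comes first in a random ordering with probability `1 / |B|`. -/
theorem uniformOn_first_le (B : Finset U) {v : U} (hv : v ∈ B) :
    uniformOn (Set.univ : Set (PointOrder U)) {π | ∀ u ∈ B,
      DFunLike.coe (F := U ≃ Fin (Fintype.card U)) π v ≤
        DFunLike.coe (F := U ≃ Fin (Fintype.card U)) π u} ≤ (B.card : ENNReal)⁻¹ := by
  classical
  set μ := uniformOn (Set.univ : Set (PointOrder U)) with hμ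
  set G : U → Set (PointOrder U) := fun w => {π | ∀ u ∈ B,
      DFunLike.coe (F := U ≃ Fin (Fintype.card U)) π w ≤
        DFunLike.coe (F := U ≃ Fin (Fintype.card U)) π u} with hG
  change μ (G v) ≤ _
  -- Exchanging `v` and `w` in the ordering carries the event that `v` is first in `B` into the one
  -- for `w`. The events for different points are disjoint, so their common bound is `1 / |B|`.
  have hsym : ∀ w ∈ B, μ (G v) ≤ μ (G w) := by
    intro w hw
    let e : PointOrder U → PointOrder U := fun π =>
      ((Equiv.swap v w).trans (show U ≃ Fin (Fintype.card U) from π) : U ≃ Fin (Fintype.card U))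
    have he : Function.Injective e := by
      intro π π' h
      have h' : ∀ u, DFunLike.coe (F := U ≃ Fin (Fintype.card U)) π (Equiv.swap v w u) =
        DFunLike.coe (F := U ≃ Fin (Fintype.card U)) π' (Equiv.swap v w u) := fun u =>
          congrArg (fun σ => DFunLike.coe (F := U ≃ Fin (Fintype.card U)) σ u) h
      refine Equiv.ext (α := U) (β := Fin (Fintype.card U)) fun u => ?_
      simpa using h' (Equiv.swap v w u)
    have hsub : e '' G v ⊆ G w := by
      rintro _ ⟨π, hπ, rfl⟩ u hu
      change DFunLike.coe (F := U ≃ Fin (Fintype.card U)) π (Equiv.swap v w w) ≤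
        DFunLike.coe (F := U ≃ Fin (Fintype.card U)) π (Equiv.swap v w u)
      rw [Equiv.swap_apply_right]
      refine hπ _ ?_
      rcases eq_or_ne u v with rfl | h1
      · rwa [Equiv.swap_apply_left]
      rcases eq_or_ne u w with rfl | h2
      · rwa [Equiv.swap_apply_right]
      · rwa [Equiv.swap_apply_of_ne_of_ne h1 h2]
    have hc : Measure.count (G v) ≤ Measure.count (G w) := by
      rw [← Measure.count_injective_image he]
      exact measure_mono hsub
    rw [hμ, uniformOn_univ, uniformOn_univ]
    gcongr
  have hdisj : (B : Set U).PairwiseDisjoint G := by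
    intro w hw w' hw' hne
    rw [Function.onFun, Set.disjoint_left]
    intro π h1 h2
    exact hne ((show U ≃ Fin (Fintype.card U) from π).injective
      (le_antisymm (h1 w' hw') (h2 w hw)))
  have hsum : ∑ w ∈ B, μ (G w) ≤ 1 := by
    rw [← measure_biUnion_finset hdisj fun _ _ => trivial]
    exact prob_le_one
  have hmul : (B.card : ENNReal) * μ (G v) ≤ 1 := by
    rw [← nsmul_eq_mul]
    exact (Finset.card_nsmul_le_sum B _ _ hsym).trans hsum
  rw [ENNReal.le_inv_iff_mul_le, mul_comm]
  exact hmul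

theorem radius_mem_Ico_le {p q c : ℝ} (hc : 0 < c) :
    ((volume : Measure ℝ)[|Set.Icc (1 / 2 : ℝ) 1]) {s | p ≤ s * c ∧ s * c < q} ≤
      ENNReal.ofReal (2 * (q - p) / c) := by
  rw [cond_apply measurableSet_Icc, Real.volume_Icc]
  have hsub : Set.Icc (1 / 2 : ℝ) 1 ∩ {s | p ≤ s * c ∧ s * c < q} ⊆ Set.Ico (p / c) (q / c) := by
    rintro s ⟨-, h1, h2⟩
    exact ⟨(div_le_iff₀ hc).2 h1, (lt_div_iff₀ hc).2 h2⟩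
  -- The density of the radius factor on `[1/2, 1]` is 2.
  have h2 : (ENNReal.ofReal (1 - 1 / 2))⁻¹ = ENNReal.ofReal 2 := by
    rw [← ENNReal.ofReal_inv_of_pos (by norm_num)]
    norm_num
  calc _ ≤ ENNReal.ofReal 2 * volume (Set.Ico (p / c) (q / c)) := by
        rw [h2]; gcongr
    _ = _ := by
        rw [Real.volume_Ico, ← ENNReal.ofReal_mul (by norm_num)]
        congr 1
        ring

end Law

section Seeds

variable {U : Type*} [Fintype U]

theorem ae_splitLaw : ∀ᵐ a ∂splitLaw U, a.2 ∈ Set.Ico (1 / 2 : ℝ) 1 := by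
  have h1 : ∀ᵐ s ∂((volume : Measure ℝ)[|Set.Icc (1 / 2 : ℝ) 1]), s ∈ Set.Ico (1 / 2 : ℝ) 1 := by
    have h2 : ∀ᵐ s ∂((volume : Measure ℝ)[|Set.Icc (1 / 2 : ℝ) 1]), s ∈ Set.Icc (1 / 2 : ℝ) 1 :=
      ae_cond_mem measurableSet_Icc
    have h3 : ∀ᵐ s ∂((volume : Measure ℝ)[|Set.Icc (1 / 2 : ℝ) 1]), s ≠ 1 :=
      cond_absolutelyContinuous.ae_le (Measure.ae_ne volume (1 : ℝ))
    filter_upwards [h2, h3] with s hs hs'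
    exact ⟨hs.1, lt_of_le_of_ne hs.2 hs'⟩
  exact Measure.quasiMeasurePreserving_snd.ae h1

theorem ae_goodSeed (L : ℕ) : ∀ᵐ τ ∂treeSeedLaw U L, ∀ i, (τ i).2 ∈ Set.Ico (1 / 2 : ℝ) 1 := by
  rw [ae_all_iff]
  intro i
  rw [treeSeedLaw_eq]
  exact (measurePreserving_eval (fun _ : Fin L × Finset U => splitLaw U)
    i).quasiMeasurePreserving.ae ae_splitLaw

end Seeds

/-! ### The expected weight of separating two points -/

section Separation

variable {U : Type*} [Fintype U] [MetricSpace U] {L : ℕ}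

/-- The weight of the nodes that contain `x` but not `y`. -/
noncomputable def sepWeight (T : Finset (Node U L)) (x y : U) : ℝ :=
  open Classical in ∑ v ∈ T.filter (fun v => x ∈ v.2 ∧ y ∉ v.2), (2 : ℝ) ^ (v.1 : ℕ)

/-- At most one node per level contains `x`, so the weights form part of a geometric sum. -/
theorem sepWeight_hst_le (τ : TreeSeed U L) {h : ℕ} {hh : h < L + 1} {S : Finset U} (x y : U) :
    sepWeight (hst τ h hh S) x y ≤ 2 ^ (h + 1) := by
  classical
  rw [sepWeight]
  set Q := (hst τ h hh S).filter fun v => x ∈ v.2 ∧ y ∉ v.2 with hQ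
  have hinj : Set.InjOn (fun v : Node U L => (v.1 : ℕ)) (Q : Set (Node U L)) := by
    intro v hv w hw hvw
    rw [Finset.mem_coe, hQ, Finset.mem_filter] at hv hw
    have heq : v.1 = w.1 := Fin.ext hvw
    refine Prod.ext heq (Finset.Subset.antisymm ?_ ?_)
    · exact (hst_laminar hv.1 hw.1 heq.le).resolve_right fun hd =>
        Finset.disjoint_left.1 hd hv.2.1 hw.2.1
    · exact (hst_laminar hw.1 hv.1 heq.ge).resolve_right fun hd =>
        Finset.disjoint_left.1 hd hw.2.1 hv.2.1
  rw [← Finset.sum_image (f := fun j : ℕ => (2 : ℝ) ^ j) hinj]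
  calc _ ≤ ∑ j ∈ Finset.range (h + 1), (2 : ℝ) ^ j := by
        refine Finset.sum_le_sum_of_subset_of_nonneg (fun j hj => ?_) fun _ _ _ => by positivity
        obtain ⟨v, hv, rfl⟩ := Finset.mem_image.1 hj
        have := (hst_le (Finset.mem_filter.1 hv).1).1
        exact Finset.mem_range.2 (by omega)
    _ ≤ _ := by
        rw [geom_sum_eq (by norm_num)]
        linarith

theorem sepWeight_hst_eq_zero (τ : TreeSeed U L) {h : ℕ} {hh : h < L + 1} {S : Finset U} {x : U}
    (hx : x ∉ S) (y : U) : sepWeight (hst τ h hh S) x y = 0 := by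
  classical
  rw [sepWeight, Finset.filter_eq_empty_iff.2, Finset.sum_empty]
  exact fun v hv h => hx ((hst_le hv).2 h.1)

theorem sepWeight_hst_succ (τ : TreeSeed U L) {h : ℕ} {hh : h + 1 < L + 1} {S S' : Finset U}
    {x y : U} (hy : y ∈ S) (hc : 1 < S.card)
    (hS' : S' ∈ ballPartition (τ (⟨h, Nat.lt_of_succ_lt_succ hh⟩, S)).1
      ((τ (⟨h, Nat.lt_of_succ_lt_succ hh⟩, S)).2 * 2 ^ h) S) (hx : x ∈ S') :
    sepWeight (hst τ (h + 1) hh S) x y = sepWeight (hst τ h (Nat.lt_of_succ_lt hh) S') x y := by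
  classical
  rw [sepWeight, sepWeight]
  congr 1
  ext v
  rw [Finset.mem_filter, Finset.mem_filter, mem_hst_succ]
  refine and_congr_left fun hv => ⟨?_, fun h => Or.inr ⟨hc, S', hS', h⟩⟩
  rintro (rfl | ⟨-, S'', hS'', hv'⟩)
  · exact absurd hy hv.2
  · rwa [eq_of_mem_ballPartition hS' hS'' hx ((hst_le hv').2 hv.1)]

-- The subtree below a node of level `h` reads only seeds with level index below `h`. Hence it is
-- independent of the seed of the split that created its root.
open scoped Classical in
theorem hst_update (τ : TreeSeed U L) (i : Fin L × Finset U) (a : PointOrder U × ℝ) {h : ℕ}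
    {hh : h < L + 1} {S : Finset U} (hi : h ≤ i.1) :
    hst (Function.update τ i a) h hh S = hst τ h hh S := by
  induction h generalizing S with
  | zero => simp only [hst]
  | succ h ih =>
    have hne : ((⟨h, Nat.lt_of_succ_lt_succ hh⟩, S) : Fin L × Finset U) ≠ i := by
      rintro rfl
      simp at hi
    simp only [hst, Function.update_of_ne hne]
    congr 1
    split_ifs
    · rfl
    · exact Finset.biUnion_congr rfl fun S' _ => ih (by omega)

/-- A split that separates `x` from `y` is due to a center that comes first among the points that
are at least as near to the pair, and whose radius lies between its two distances. -/
theorem exists_cutting_center {π : U ≃ Fin (Fintype.card U)} {r : ℝ} (hr : 0 ≤ r)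
    {S S' : Finset U} (hS' : S' ∈ ballPartition π r S) {x y : U} (hx : x ∈ S') (hyS : y ∈ S)
    (hy : y ∉ S') : ∃ v ∈ S, min (dist v x) (dist v y) ≤ r ∧ r < max (dist v x) (dist v y) ∧
      ∀ u ∈ S, min (dist u x) (dist u y) ≤ min (dist v x) (dist v y) → π v ≤ π u := by
  classical
  have hxS := subset_of_mem_ballPartition hS' hx
  obtain ⟨v, hv, hmin⟩ := Finset.exists_min_image
    (S.filter fun v => min (dist v x) (dist v y) ≤ r) π
    ⟨x, Finset.mem_filter.2 ⟨hxS, by simp [hr]⟩⟩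
  rw [Finset.mem_filter] at hv
  refine ⟨v, hv.1, hv.2, ?_, fun u hu hle => hmin u (Finset.mem_filter.2 ⟨hu, hle.trans hv.2⟩)⟩
  by_contra! hmax
  have hearly : ∀ v' ∈ S, π v' < π v → ¬ min (dist v' x) (dist v' y) ≤ r := fun v' hv' hlt h =>
    absurd (hmin v' (Finset.mem_filter.2 ⟨hv', h⟩)) (not_le.2 hlt)
  have hxv : x ∈ ballCluster π r S v := mem_ballCluster.2 ⟨hxS, (le_max_left _ _).trans hmax,
    fun v' hv' hlt h => hearly v' hv' hlt ((min_le_left _ _).trans h)⟩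
  have hyv : y ∈ ballCluster π r S v := mem_ballCluster.2 ⟨hyS, (le_max_right _ _).trans hmax,
    fun v' hv' hlt h => hearly v' hv' hlt ((min_le_right _ _).trans h)⟩
  have heq := eq_of_mem_ballPartition hS' (mem_ballPartition.2 ⟨⟨v, hv.1, rfl⟩, x, hxv⟩) hx hxv
  exact hy (heq ▸ hyv)

open scoped Classical in
/-- The event that `v` comes first among the points of `S` that are at least as near to the pair
`x, y`, and that the radius lies between its two distances. -/
def cutEvent (S : Finset U) (x y : U) (c : ℝ) (v : U) : Set (PointOrder U × ℝ) :=
  {π : PointOrder U | ∀ u ∈ S.filter (fun u =>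
      min (dist u x) (dist u y) ≤ min (dist v x) (dist v y)),
    DFunLike.coe (F := U ≃ Fin (Fintype.card U)) π v ≤
      DFunLike.coe (F := U ≃ Fin (Fintype.card U)) π u} ×ˢ
  {s | min (dist v x) (dist v y) ≤ s * c ∧ s * c < max (dist v x) (dist v y)}

theorem measurableSet_cutEvent (S : Finset U) (x y : U) (c : ℝ) (v : U) :
    MeasurableSet (cutEvent S x y c v) := by
  refine MeasurableSet.prod trivial ?_
  exact (measurableSet_le measurable_const (measurable_id.mul_const c)).inter
    (measurableSet_lt (measurable_id.mul_const c) measurable_const)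

/-- The ordering and the radius are independent: the first contributes the inverse of the rank of
`v`, the second a window of length at most `dist x y` by the triangle inequality. -/
theorem splitLaw_cutEvent_le {S : Finset U} {v : U} (hv : v ∈ S) (x y : U) {c : ℝ} (hc : 0 < c) :
    splitLaw U (cutEvent S x y c v) ≤ ENNReal.ofReal (2 * dist x y / c *
      (countLe (fun u => min (dist u x) (dist u y)) S (min (dist v x) (dist v y)) : ℝ)⁻¹) := by
  classical
  set m : U → ℝ := fun u => min (dist u x) (dist u y) with hm
  have hpos : 0 < countLe m S (m v) :=
    Finset.card_pos.2 ⟨v, Finset.mem_filter.2 ⟨hv, le_rfl⟩⟩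
  have hd : max (dist v x) (dist v y) - min (dist v x) (dist v y) ≤ dist x y := by
    rw [max_sub_min_eq_abs]
    have := abs_dist_sub_le y x v
    rwa [dist_comm y v, dist_comm x v, dist_comm y x] at this
  rw [splitLaw, cutEvent, Measure.prod_prod, mul_comm (2 * dist x y / c),
    ENNReal.ofReal_mul (by positivity),
    ENNReal.ofReal_inv_of_pos (by exact_mod_cast hpos), ENNReal.ofReal_natCast]
  refine mul_le_mul' ?_ ?_
  · exact uniformOn_first_le _ (Finset.mem_filter.2 ⟨hv, le_rfl⟩)
  · refine (radius_mem_Ico_le hc).trans (ENNReal.ofReal_le_ofReal ?_)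
    gcongr

/-- The bound for the expected weight of the nodes that separate `x` from `y` in the subtree of a
node of level `h`. -/
noncomputable def sepBound (x y : U) (S : Finset U) (h : ℕ) : ℝ :=
  4 * dist x y * (harmonic (countLe (fun u => min (dist u x) (dist u y)) S (2 ^ h / 2)) +
    harmonic (countLe (fun u => min (dist u x) (dist u y)) S (2 ^ h / 4))) + 8 * dist x y

theorem harmonic_nonneg (n : ℕ) : (0 : ℝ) ≤ harmonic n := by
  have := harmonic_mono (Nat.zero_le n)
  simpa using this

omit [Fintype U] in
theorem sepBound_nonneg (x y : U) (S : Finset U) (h : ℕ) : 0 ≤ sepBound x y S h := by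
  have h1 := harmonic_nonneg (countLe (fun u => min (dist u x) (dist u y)) S (2 ^ h / 2))
  have h2 := harmonic_nonneg (countLe (fun u => min (dist u x) (dist u y)) S (2 ^ h / 4))
  rw [sepBound]
  positivity

omit [Fintype U] in
theorem sepBound_mono (x y : U) {S S' : Finset U} (hS : S' ⊆ S) (h : ℕ) :
    sepBound x y S' h ≤ sepBound x y S h := by
  have h1 := harmonic_mono
    (countLe_mono (fun u => min (dist u x) (dist u y)) hS (2 ^ h / 2))
  have h2 := harmonic_mono
    (countLe_mono (fun u => min (dist u x) (dist u y)) hS (2 ^ h / 4))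
  rw [sepBound, sepBound]
  gcongr

theorem measurable_sepWeight {h : ℕ} {hh : h < L + 1} {S : Finset U} (x y : U) :
    Measurable fun τ : TreeSeed U L => ENNReal.ofReal (sepWeight (hst τ h hh S) x y) :=
  (fiberMeasurable_hst h hh S).measurable fun T => ENNReal.ofReal (sepWeight T x y)

/-- Induction over levels, resampling the top split. If it separates `x` from `y`, the weight is at
most `2 ^ (h + 1)`; otherwise the bound of level `h` applies to the common cluster. The two harmonic
terms of `sepBound` are there because the relevant centers at one split lie within a factor 4 in
distance, that is, two levels, so the sum telescopes with step two. -/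
theorem lintegral_sepWeight_le (x y : U) {h : ℕ} {hh : h < L + 1} {S : Finset U}
    (hS : x ∈ S → y ∈ S) :
    ∫⁻ τ, ENNReal.ofReal (sepWeight (hst τ h hh S) x y) ∂treeSeedLaw U L ≤
      ENNReal.ofReal (sepBound x y S h) := by
  classical
  rcases eq_or_ne x y with rfl | hxy
  · simp [sepWeight]
  induction h generalizing S with
  | zero =>
    have h0 : ∀ τ : TreeSeed U L, sepWeight (hst τ 0 hh S) x y = 0 := by
      intro τ
      rw [sepWeight, hst, Finset.filter_eq_empty_iff.2, Finset.sum_empty]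
      intro v hv h
      rw [Finset.mem_singleton.1 hv] at h
      exact h.2 (hS h.1)
    simp [h0]
  | succ h ih =>
    by_cases hxS : x ∈ S
    swap
    · simp [sepWeight_hst_eq_zero _ hxS]
    have hyS := hS hxS
    have hd : 0 < dist x y := dist_pos.2 hxy
    set m : U → ℝ := fun u => min (dist u x) (dist u y) with hm
    -- For far points the trivial bound `2 ^ (h + 1) < 8 * dist x y` suffices; this is the origin of
    -- the last term of `sepBound`.
    rcases lt_or_ge (2 ^ h / 4 : ℝ) (dist x y) with hfar | hnear
    · calc _ ≤ ∫⁻ _τ, ENNReal.ofReal (sepBound x y S (h + 1)) ∂treeSeedLaw U L := by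
            refine lintegral_mono fun τ => ENNReal.ofReal_le_ofReal ?_
            have hcard : 1 < S.card := Finset.one_lt_card.2 ⟨x, hxS, y, hyS, hxy⟩
            have hle : sepWeight (hst τ (h + 1) hh S) x y ≤ 2 ^ (h + 1) := by
              -- The estimate is for every seed, also for a negative radius, where `x` may lie in no
              -- cluster and the weight is zero.
              by_cases hex : ∃ S' ∈ ballPartition (τ (⟨h, Nat.lt_of_succ_lt_succ hh⟩, S)).1
                  ((τ (⟨h, Nat.lt_of_succ_lt_succ hh⟩, S)).2 * 2 ^ h) S, x ∈ S'
              · obtain ⟨S', hS', hxS'⟩ := hex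
                rw [sepWeight_hst_succ τ hyS hcard hS' hxS']
                exact sepWeight_hst_le τ x y
              · rw [sepWeight, Finset.filter_eq_empty_iff.2]
                · simp only [Finset.sum_empty]
                  positivity
                · intro v hv hv'
                  rcases mem_hst_succ.1 hv with rfl | ⟨-, S', hS', hvS'⟩
                  · exact hv'.2 hyS
                  · exact hex ⟨S', hS', (hst_le hvS').2 hv'.1⟩
            have h1 := harmonic_nonneg (countLe m S (2 ^ (h + 1) / 2))
            have h2 := harmonic_nonneg (countLe m S (2 ^ (h + 1) / 4))
            have h3 : 8 * dist x y ≤ sepBound x y S (h + 1) := by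
              rw [sepBound]
              have : 0 ≤ 4 * dist x y * ((harmonic (countLe m S (2 ^ (h + 1) / 2)) : ℝ) +
                harmonic (countLe m S (2 ^ (h + 1) / 4))) := by positivity
              linarith
            rw [pow_succ] at hle
            linarith
        _ = _ := by simp
    set i : Fin L × Finset U := (⟨h, Nat.lt_of_succ_lt_succ hh⟩, S) with hi
    set Q := S.filter fun v => (2 ^ h / 4 : ℝ) < m v ∧ m v ≤ 2 ^ h with hQ
    have h2h : (0 : ℝ) < 2 ^ h := by positivity
    set g : PointOrder U × ℝ → ENNReal := fun a =>
      (∑ v ∈ Q, (cutEvent S x y (2 ^ h) v).indicator (fun _ => ENNReal.ofReal (2 ^ (h + 1))) a) +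
        ENNReal.ofReal (sepBound x y S h) with hg
    have hstep : ∫⁻ τ, ENNReal.ofReal (sepWeight (hst τ (h + 1) hh S) x y) ∂treeSeedLaw U L ≤
        ∫⁻ a, g a ∂splitLaw U := by
      rw [treeSeedLaw_eq] at ih ⊢
      refine lintegral_pi_le_update (fun _ : Fin L × Finset U => splitLaw U) i
        (measurable_sepWeight x y) ?_
      filter_upwards [ae_splitLaw] with a ha
      have hcard : 1 < S.card := Finset.one_lt_card.2 ⟨x, hxS, y, hyS, hxy⟩
      have hr : 0 ≤ a.2 * 2 ^ h := mul_nonneg (by linarith [ha.1]) h2h.le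
      obtain ⟨S', hS', hxS'⟩ := exists_mem_ballPartition (π := a.1) hr hxS
      have heq : ∀ τ : TreeSeed U L, sepWeight (hst (Function.update τ i a) (h + 1) hh S) x y =
          sepWeight (hst τ h (Nat.lt_of_succ_lt hh) S') x y := by
        intro τ
        rw [sepWeight_hst_succ (S' := S') _ hyS hcard ?_ hxS', hst_update _ _ _ le_rfl]
        rw [← hi, Function.update_self]
        exact hS'
      simp only [heq]
      by_cases hyS' : y ∈ S'
      -- The cluster `S'` depends on the seed; monotonicity in `S` replaces its bound by a fixed
      -- one.
      · refine (ih fun _ => hyS').trans ?_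
        rw [hg]
        exact (ENNReal.ofReal_le_ofReal
          (sepBound_mono x y (subset_of_mem_ballPartition hS') h)).trans le_add_self
      · obtain ⟨v, hv, hv1, hv2, hv3⟩ := exists_cutting_center hr hS' hxS' hyS hyS'
        have hmax : max (dist v x) (dist v y) ≤ m v + dist x y := by
          have := abs_dist_sub_le y x v
          rw [dist_comm y v, dist_comm x v, dist_comm y x, ← max_sub_min_eq_abs] at this
          linarith
        -- The radius is at least `2 ^ h / 2` and less than `m v + dist x y`, with `dist x y ≤ 2 ^ h
        -- / 4`, so `m v > 2 ^ h / 4`; also `m v` is at most the radius.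
        have hvQ : v ∈ Q := by
          refine Finset.mem_filter.2 ⟨hv, ?_, ?_⟩
          · have : 1 / 2 * (2 : ℝ) ^ h ≤ a.2 * 2 ^ h := by gcongr; exact ha.1
            linarith
          · have : a.2 * 2 ^ h ≤ 1 * (2 : ℝ) ^ h := by gcongr; exact ha.2.le
            linarith
        have hacut : a ∈ cutEvent S x y (2 ^ h) v :=
          ⟨fun u hu => hv3 u (Finset.mem_filter.1 hu).1 (Finset.mem_filter.1 hu).2, hv1, hv2⟩
        calc _ ≤ ∫⁻ _τ, ENNReal.ofReal (2 ^ (h + 1))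
              ∂Measure.pi fun _ : Fin L × Finset U => splitLaw U :=
              lintegral_mono fun τ => ENNReal.ofReal_le_ofReal (sepWeight_hst_le τ x y)
          _ = (cutEvent S x y (2 ^ h) v).indicator (fun _ => ENNReal.ofReal (2 ^ (h + 1))) a := by
              rw [Set.indicator_of_mem hacut]; simp
          _ ≤ ∑ v ∈ Q, (cutEvent S x y (2 ^ h) v).indicator
              (fun _ => ENNReal.ofReal (2 ^ (h + 1))) a :=
              Finset.single_le_sum (f := fun v => (cutEvent S x y (2 ^ h) v).indicator
                (fun _ => ENNReal.ofReal (2 ^ (h + 1))) a) (fun _ _ => zero_le) hvQ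
          _ ≤ g a := le_self_add
    refine hstep.trans ?_
    have hint : ∫⁻ a, g a ∂splitLaw U = ∑ v ∈ Q, ENNReal.ofReal (2 ^ (h + 1)) *
        splitLaw U (cutEvent S x y (2 ^ h) v) + ENNReal.ofReal (sepBound x y S h) := by
      rw [hg, lintegral_add_right _ measurable_const, lintegral_finsetSum]
      · simp [lintegral_indicator_const (measurableSet_cutEvent S x y (2 ^ h) _)]
      · exact fun v _ => measurable_const.indicator (measurableSet_cutEvent S x y (2 ^ h) v)
    rw [hint]
    calc _ ≤ ∑ v ∈ Q, ENNReal.ofReal (4 * dist x y * (countLe m S (m v) : ℝ)⁻¹) +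
          ENNReal.ofReal (sepBound x y S h) := by
          gcongr with v hv
          refine (mul_le_mul_right (splitLaw_cutEvent_le (Finset.mem_filter.1 hv).1 x y h2h) _).trans
            (le_of_eq ?_)
          rw [← ENNReal.ofReal_mul (by positivity)]
          congr 1
          rw [pow_succ]
          field_simp
          ring
      _ = ENNReal.ofReal (4 * dist x y * ∑ v ∈ Q, (countLe m S (m v) : ℝ)⁻¹ +
          sepBound x y S h) := by
          rw [← ENNReal.ofReal_sum_of_nonneg fun v _ => by positivity, ← Finset.mul_sum,
            ← ENNReal.ofReal_add (by positivity) (sepBound_nonneg x y S h)]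
      _ ≤ _ := by
          refine ENNReal.ofReal_le_ofReal ?_
          -- The cut term is exactly the difference of the bounds at levels `h + 1` and `h`: the
          -- harmonic numbers at `2 ^ h / 2` cancel.
          have h1 := sum_inv_countLe_le m S (by linarith : (2 ^ h / 4 : ℝ) ≤ 2 ^ h)
          have h2 : 4 * dist x y * ∑ v ∈ Q, (countLe m S (m v) : ℝ)⁻¹ ≤ 4 * dist x y *
            ((harmonic (countLe m S (2 ^ h)) : ℝ) - harmonic (countLe m S (2 ^ h / 4))) := by
            gcongr
          have h3 : (2 : ℝ) ^ (h + 1) / 2 = 2 ^ h := by rw [pow_succ]; ring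
          have h4 : (2 : ℝ) ^ (h + 1) / 4 = 2 ^ h / 2 := by rw [pow_succ]; ring
          rw [sepBound, sepBound, h3, h4]
          linarith

/-- The expected tree distance exceeds the distance by a factor of order `log n`. -/
theorem integral_sepWeight_le (x y : U) :
    ∫ τ, sepWeight (hstTree τ) x y ∂treeSeedLaw U L ≤
      (16 + 8 * Real.log (Fintype.card U)) * dist x y := by
  classical
  have hnn : ∀ τ : TreeSeed U L, 0 ≤ sepWeight (hstTree τ) x y := fun τ =>
    Finset.sum_nonneg fun _ _ => by positivity
  have h1 : ∫ τ, sepWeight (hstTree τ) x y ∂treeSeedLaw U L ≤ sepBound x y Finset.univ L := by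
    rw [integral_eq_lintegral_of_nonneg_ae (Filter.Eventually.of_forall hnn)
      (fiberMeasurable_hstTree.measurable fun T => sepWeight T x y).aestronglyMeasurable]
    exact ENNReal.toReal_le_of_le_ofReal (sepBound_nonneg _ _ _ _)
      (lintegral_sepWeight_le x y fun _ => Finset.mem_univ y)
  have h2 : ∀ r, (harmonic (countLe (fun u => min (dist u x) (dist u y)) Finset.univ r) : ℝ) ≤
      1 + Real.log (Fintype.card U) := fun r =>
    (harmonic_mono (Finset.card_le_univ _)).trans (harmonic_le_one_add_log _)
  refine h1.trans ?_
  have h3 := h2 (2 ^ L / 2)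
  have h4 := h2 (2 ^ L / 4)
  rw [sepBound]
  have hd : 0 ≤ dist x y := dist_nonneg
  nlinarith

theorem integrable_comp_hstTree (g : Finset (Node U L) → ℝ) :
    Integrable (fun τ => g (hstTree τ)) (treeSeedLaw U L) := by
  obtain ⟨B, hB⟩ := (Set.finite_range fun T => ‖g T‖).bddAbove
  exact Integrable.of_bound (fiberMeasurable_hstTree.measurable g).aestronglyMeasurable B
    (Filter.Eventually.of_forall fun τ => hB ⟨_, rfl⟩)

/-- A node around `p` that misses `F` separates `p` from its nearest point of `F`. -/
theorem integral_missWeight_le (D : Finset U) {F : Finset U} (hF : F.Nonempty) :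
    ∫ τ, missWeight (hstTree τ) D F ∂treeSeedLaw U L ≤
      (16 + 8 * Real.log (Fintype.card U)) * cost F D := by
  classical
  have hnear : ∀ p : U, ∃ f ∈ F, Metric.infDist p (F : Set U) = dist p f := fun p =>
    F.finite_toSet.isCompact.exists_infDist_eq_dist (Finset.coe_nonempty.2 hF) p
  choose f hfF hf using hnear
  calc _ ≤ ∫ τ, ∑ p ∈ D, sepWeight (hstTree τ) p (f p) ∂treeSeedLaw U L := by
        refine integral_mono (integrable_comp_hstTree fun T => missWeight T D F)
          (integrable_comp_hstTree fun T => ∑ p ∈ D, sepWeight T p (f p)) fun τ => ?_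
        simp only
        rw [missWeight_eq_sum]
        refine Finset.sum_le_sum fun p _ => ?_
        refine Finset.sum_le_sum_of_subset_of_nonneg (fun v hv => ?_) fun _ _ _ => by positivity
        rw [Finset.mem_filter] at hv ⊢
        exact ⟨hv.1, hv.2.2, fun h => Finset.disjoint_left.1 hv.2.1 h (hfF p)⟩
    _ = ∑ p ∈ D, ∫ τ, sepWeight (hstTree τ) p (f p) ∂treeSeedLaw U L :=
        integral_finsetSum _ fun p _ => integrable_comp_hstTree fun T => sepWeight T p (f p)
    _ ≤ ∑ p ∈ D, (16 + 8 * Real.log (Fintype.card U)) * dist p (f p) :=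
        Finset.sum_le_sum fun p _ => integral_sepWeight_le p (f p)
    _ = _ := by
        rw [cost, Finset.mul_sum]
        exact Finset.sum_congr rfl fun p _ => by rw [hf p]

end Separation

/-! ### Combining the tree and the noise -/

theorem exists_cost_eq_opt {U : Type*} [Fintype U] [MetricSpace U] {k : ℕ}
    (hk : k ≤ Fintype.card U) (D : Finset U) :
    ∃ F : Finset U, F.card = k ∧ cost F D = opt k D := by
  obtain ⟨F₀, -, hF₀⟩ := Finset.exists_subset_card_eq (s := (Finset.univ : Finset U)) (n := k) hk
  have : Nonempty {F : Finset U // F.card = k} := ⟨⟨F₀, hF₀⟩⟩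
  obtain ⟨F, hF⟩ := exists_eq_ciInf_of_finite
    (f := fun F : {F : Finset U // F.card = k} => cost F.1 D)
  exact ⟨F.1, F.2, hF⟩

theorem log_mul_succ_le {n L A : ℕ} (hn : 2 ≤ n) (hL : L ≤ n ^ A) :
    Real.log (n * (L + 1)) ≤ (A + 2) * Real.log n := by
  have h1 : n * (L + 1) ≤ n ^ (A + 2) := by
    have h2 : 1 ≤ n ^ A := Nat.one_le_pow _ _ (by omega)
    have h3 : L + 1 ≤ n ^ A * n := by nlinarith
    calc n * (L + 1) ≤ n * (n ^ A * n) := Nat.mul_le_mul_left n h3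
      _ = n ^ (A + 2) := by ring
  have h4 : ((n : ℝ) * (L + 1)) ≤ (n : ℝ) ^ (A + 2) := by exact_mod_cast h1
  have hn0 : (0 : ℝ) < n := by exact_mod_cast (by omega : 0 < n)
  calc Real.log (n * (L + 1)) ≤ Real.log ((n : ℝ) ^ (A + 2)) :=
        Real.log_le_log (by positivity) h4
    _ = _ := by rw [Real.log_pow]; push_cast; ring

theorem integrable_cost_dpHst {U : Type*} [Fintype U] [MetricSpace U] {L : ℕ} (D : Finset U)
    (k : ℕ) (μ : Measure (TreeSeed U L × (Node U L → ℝ))) [IsFiniteMeasure μ] :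
    Integrable (fun ω => cost (dpHst D k ω) D) μ := by
  obtain ⟨B, hB⟩ := (Set.finite_range fun F : Finset U => ‖cost F D‖).bddAbove
  exact Integrable.of_bound
    ((fiberMeasurable_dpHst D k).measurable fun F => cost F D).aestronglyMeasurable B
    (Filter.Eventually.of_forall fun ω => hB ⟨_, rfl⟩)

theorem integral_cost_dpHst_prod_le {U : Type*} [Fintype U] [MetricSpace U] [Nonempty U] {L : ℕ}
    (hU : ∀ x y : U, x ≠ y → 1 ≤ dist x y) (hdiam : ∀ x y : U, dist x y ≤ 2 ^ L) (hL : 1 ≤ L)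
    (D : Finset U) {k : ℕ} (hk : 1 ≤ k) (hkU : k ≤ Fintype.card U) {ε : ℝ} (hε : 0 < ε) :
    ∫ ω, cost (dpHst D k ω) D ∂dpHstLaw U L ε ≤
      12 * ((16 + 8 * Real.log (Fintype.card U)) * opt k D) +
        16 * k * (2 ^ L / ε * (2 * Real.log (Fintype.card U * (L + 1)) + 4)) := by
  have := isProbabilityMeasure_noiseLaw U L hε
  obtain ⟨F, hFk, hF⟩ := exists_cost_eq_opt hkU D
  have hint := integrable_cost_dpHst D k ((treeSeedLaw U L).prod (noiseLaw U L ε))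
  rw [dpHstLaw, integral_prod _ hint]
  have hmiss : Integrable (fun τ => 12 * missWeight (hstTree τ) D F) (treeSeedLaw U L) :=
    (integrable_comp_hstTree fun T => missWeight T D F).const_mul _
  refine (integral_mono_ae hint.integral_prod_left (hmiss.add (integrable_const
    (16 * k * (2 ^ L / ε * (2 * Real.log (Fintype.card U * (L + 1)) + 4))))) ?_).trans ?_
  · filter_upwards [ae_goodSeed L] with τ hτ
    exact integral_cost_dpHst_le hU hdiam hL hτ D hk hkU hε hFk
  · have h1 := integral_missWeight_le (L := L) D (F := F) (Finset.card_pos.1 (by omega))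
    rw [hF] at h1
    simp only [Pi.add_apply]
    rw [integral_add hmiss (integrable_const _), integral_const_mul]
    simp only [integral_const, probReal_univ, one_smul]
    gcongr

end KMedian


theorem mainTheorem2 (A : ℕ) :
    ∃ C : ℝ, 0 < C ∧
      ∀ (U : Type*) [Fintype U] [MetricSpace U] (L : ℕ) (Δ ε : ℝ) (k : ℕ) (D : Finset U),
        (∀ x y : U, x ≠ y → 1 ≤ dist x y) →
        Δ = Metric.diam (Set.univ : Set U) →
        Δ = 2 ^ L →
        1 ≤ L →
        L ≤ Fintype.card U ^ A →
        1 ≤ k →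
        k ≤ Fintype.card U →
        0 < ε →
        (∀ᵐ ω ∂(KMedian.dpHstLaw U L ε), (KMedian.dpHst D k ω).card = k) ∧
        Integrable (fun ω => KMedian.cost (KMedian.dpHst D k ω) D) (KMedian.dpHstLaw U L ε) ∧
        ∫ ω, KMedian.cost (KMedian.dpHst D k ω) D ∂(KMedian.dpHstLaw U L ε) ≤
          C * Real.log (Fintype.card U) *
            (KMedian.opt k D + k * ε⁻¹ * Δ * Real.log (Fintype.card U)) := by

  -- The positive diameter forces `n ≥ 2`, so `l = log n` is at least `1/2`. Then `12 * (16 + 8 * l)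
  -- ≤ 480 * l`, and `2 * (A + 2) * l + 4 ≤ (2 * A + 12) * l`. The noise term is only linear in `l`;
  -- the stated bound has `l * l`, reached by `l ≤ 2 * (l * l)`, so `16 * 2 = 32`.
  refine ⟨480 + 32 * (2 * A + 12), by positivity, ?_⟩
  intro U _ _ L Δ ε k D hU hdiam hΔ hL hLA hk hkU hε
  have hne : Nonempty U := Fintype.card_pos_iff.1 (by omega)
  have hdist : ∀ x y : U, dist x y ≤ 2 ^ L := by
    intro x y
    rw [← hΔ, hdiam]
    exact Metric.dist_le_diam_of_mem (Set.toFinite _).isBounded (Set.mem_univ x) (Set.mem_univ y)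
  have hn : 2 ≤ Fintype.card U := by
    by_contra! hlt
    have : Subsingleton U := Fintype.card_le_one_iff_subsingleton.1 (by omega)
    rw [Metric.diam_subsingleton Set.subsingleton_univ, hΔ] at hdiam
    exact absurd hdiam (by positivity)
  have := KMedian.isProbabilityMeasure_noiseLaw U L hε
  refine ⟨?_, ?_, ?_⟩
  · have h1 : ∀ᵐ ω ∂KMedian.dpHstLaw U L ε, KMedian.GoodSeed ω.1 :=
      Measure.quasiMeasurePreserving_fst.ae (KMedian.ae_goodSeed L)
    filter_upwards [h1] with ω hω
    exact (KMedian.cost_dpHst_le hU hdist hL hω D hk hkU ω.2).1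
  · exact KMedian.integrable_cost_dpHst D k ((KMedian.treeSeedLaw U L).prod _)
  · refine (KMedian.integral_cost_dpHst_prod_le hU hdist hL D hk hkU hε).trans ?_
    set l := Real.log (Fintype.card U) with hl
    have hl2 : 1 / 2 ≤ l := by
      have h1 : Real.log 2 ≤ l := Real.log_le_log (by norm_num) (by exact_mod_cast hn)
      linarith [Real.log_two_gt_d9]
    have hlog : Real.log (Fintype.card U * (L + 1)) ≤ (A + 2) * l :=
      KMedian.log_mul_succ_le hn hLA
    have hopt : 0 ≤ KMedian.opt k D := by
      obtain ⟨F, -, hF⟩ := KMedian.exists_cost_eq_opt hkU D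
      rw [← hF]
      exact KMedian.cost_nonneg F D
    set P : ℝ := k * ε⁻¹ * Δ with hP
    have hP0 : 0 ≤ P := by
      rw [hP, hΔ]
      positivity
    have hA : (0 : ℝ) ≤ A := Nat.cast_nonneg A
    have h1 : 12 * ((16 + 8 * l) * KMedian.opt k D) ≤ 480 * (l * KMedian.opt k D) := by
      nlinarith
    have h2 : 16 * k * (2 ^ L / ε * (2 * Real.log (Fintype.card U * (L + 1)) + 4)) =
        16 * P * (2 * Real.log (Fintype.card U * (L + 1)) + 4) := by
      rw [hP, hΔ]
      ring
    have h3 : 2 * Real.log (Fintype.card U * (L + 1)) + 4 ≤ 2 * (2 * A + 12) * (l * l) := by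
      have h4 : 2 * Real.log (Fintype.card U * (L + 1)) + 4 ≤ (2 * A + 12) * l := by
        linarith
      have h5 : l ≤ 2 * (l * l) := by nlinarith
      have h6 : (2 * A + 12) * l ≤ (2 * A + 12) * (2 * (l * l)) := by gcongr
      linarith
    have h4 : 16 * P * (2 * Real.log (Fintype.card U * (L + 1)) + 4) ≤
        16 * P * (2 * (2 * A + 12) * (l * l)) := by gcongr
    have h5 : 0 ≤ 32 * (2 * (A : ℝ) + 12) * (l * KMedian.opt k D) := by positivity
    have h6 : 0 ≤ 480 * (P * (l * l)) := by positivity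
    rw [h2]
    linarith
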